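/- **Setting.** A two-component mixture in $\mathbb R^3$ is observed during an open set of instants. Each constituent $\alpha\in\{s,f\}$ (solid, fluid) has an open reference configuration $\mathcal B_\alpha\subseteq\mathbb R^3$ and a motion $\boldsymbol\chi_\alpha(\mathbf X,t)$ of class $C^2$, whose configurations $\boldsymbol\chi_\alpha(\cdot,t)$ are one-to-one with $\det\mathbf F_\alpha>0$, where $\mathbf F_\alpha=\operatorname{Grad}\boldsymbol\chi_\alpha$. Let $\mathbf v_\alpha(\mathbf x,t)$ be the spatial velocity and $\phi_\alpha=1/\det\mathbf F_\alpha$ the bulk specific volume, as a spatial field. Write $\mathbf F=\mathbf F_s$. The region engaged by the solid is contained in the region engaged by the fluid: $\boldsymbol\chi_s(\mathcal B_s,t)\subseteq\boldsymbol\chi_f(\mathcal B_f,t)$. Given are the referential free energy $\Psi_s(\mathbf X,t)$ of the solid (of class $C^1$), and, on the region engaged by the solid, the partial stress $\mathbf T_s(\mathbf x,t)$ (continuous in $\mathbf x$) and the pressure $\lambda(\mathbf x,t)$ ($C^1$ in $\mathbf x$), together with the molar volume $v>0$ of the fluid. Put $$\psi_s=\phi_s\Psi_s,\quad \mathbf T=\mathbf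 T_s+\mathbf T_f,\quad \mathbf T_f=-\phi_f\lambda\mathbf I,\quad \mu=v\lambda,\quad \mathbf h=\frac{\phi_f}{v}(\mathbf v_f-\mathbf v_s),$$ $$\mathbf T_R=(\det\mathbf F)\,\mathbf T\,\mathbf F^{-\mathsf T},\qquad \mathbf h_R=(\det\mathbf F)\,\mathbf F^{-1}\mathbf h ,$$ the last two being fields on $\mathcal B_s$ (spatial fields are composed with $\boldsymbol\chi_s(\cdot,t)$). $\operatorname{Grad}_R$ is the referential gradient, a superposed dot is the time derivative at fixed $\mathbf X$, and $\mathbf A\cdot\mathbf B=\operatorname{tr}(\mathbf A^{\mathsf T}\mathbf B)$ for tensors. A *regular region* is a bounded open set whose boundary has finite area and, except for a set of zero area (edges, corners, ...), is locally a $C^1$ surface with the set on one side only; $\mathbf n$ (in the reference configuration, $\mathbf n_R$) is the outward unit normal. **Proposition.** For every instant $t$ the following are equivalent. 1. For every control volume $\Omega$ engaged by the solid at time $t$, i.e. every regular region $\Omega$ with $\overline\Omega\subset\boldsymbol\chi_s(\mathcal B_s,t)$, the function $\tau\mapsto\int_\Omega\psi_s(\cdot,\tau)$ is differentiable at $t$,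 and at time $t$ $$\frac{\mathrm d}{\mathrm dt}\int_\Omega\psi_s+\int_{\partial\Omega}\psi_s\,\mathbf v_s\cdot\mathbf n\;\le\;\int_\Omega\mathbf T\cdot\operatorname{grad}\mathbf v_s-\int_{\partial\Omega}\mu\,\mathbf h\cdot\mathbf n .$$ 2. For every body part $\mathcal P_s$ of the solid, i.e. every regular region $\mathcal P_s$ with $\overline{\mathcal P_s}\subset\mathcal B_s$, at time $t$ $$\int_{\mathcal P_s}\dot\Psi_s\;\le\;\int_{\mathcal P_s}\mathbf T_R\cdot\operatorname{Grad}_R\mathbf v_s-\int_{\partial\mathcal P_s}\mu\,\mathbf h_R\cdot\mathbf n_R .$$ -/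

import Mathlib

open MeasureTheory Topology
open scoped Gradient

noncomputable section

namespace Poro

/-- Three-dimensional Euclidean space. -/
abbrev Space : Type := EuclideanSpace ℝ (Fin 3)

/-- Second-order tensors. -/
abbrev Tensor : Type := Space →L[ℝ] Space

/-- The scalar product `A · B = tr (Aᵀ B)` of tensors. -/
def tensorInner (A B : Tensor) : ℝ :=
  LinearMap.trace ℝ Space ((ContinuousLinearMap.adjoint A ∘L B : Tensor) : Space →ₗ[ℝ] Space)

/-! ### Regions, outward unit normals, boundary fluxes -/

/-- `n` is the outward unit normal of `Ω` at `x`: near `x` the set `Ω` is the sublevel set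
`{ρ < 0}` of a `C¹` function `ρ` with `ρ x = 0` and `∇ ρ x ≠ 0`, and `n = ∇ ρ x / |∇ ρ x|`.
(The boundary of `Ω` is then a `C¹` surface near `x`, with `Ω` on one side only, and `n` does not
depend on `ρ`.) -/
def IsOutwardUnitNormal (Ω : Set Space) (x n : Space) : Prop :=
  ∃ (U : Set Space) (ρ : Space → ℝ),
    IsOpen U ∧ x ∈ U ∧ ContDiffOn ℝ 1 ρ U ∧ ρ x = 0 ∧ ∇ ρ x ≠ 0 ∧
    Ω ∩ U = {y ∈ U | ρ y < 0} ∧ n = ‖∇ ρ x‖⁻¹ • ∇ ρ x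

open Classical in
/-- The outward unit normal field of `Ω` (set to `0` where there is none). -/
def outwardNormal (Ω : Set Space) (x : Space) : Space :=
  if h : ∃ n, IsOutwardUnitNormal Ω x n then h.choose else 0

/-- Regular regions: bounded open sets whose boundary has finite area and is, up to a set of zero
area (edges, corners, ...), a `C¹` surface with the set on one side. Here `μHE[2]` is the
two-dimensional Hausdorff measure of space, normalised to be surface area. -/
structure IsRegularRegion (Ω : Set Space) : Prop where
  isOpen : IsOpen Ω
  isBounded : Bornology.IsBounded Ω
  area_ne_top : μHE[2] (frontier Ω) ≠ ⊤
  ae_normal : ∀ᵐ x ∂((μHE[2] : Measure Space).restrict (frontier Ω)),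
    ∃ n, IsOutwardUnitNormal Ω x n

/-- The surface integral `∫_{∂Ω} a · n`. -/
def boundaryFlux (Ω : Set Space) (a : Space → Space) : ℝ :=
  ∫ x in frontier Ω, inner ℝ (a x) (outwardNormal Ω x) ∂μHE[2]

/-! ### Constituents -/

/-- A constituent of a mixture, observed during the set `times` of instants: an open reference
configuration and a motion whose configurations are one-to-one with positive Jacobian. -/
structure Constituent (times : Set ℝ) where
  body : Set Space
  isOpen_body : IsOpen body
  motion : Space → ℝ → Space
  contDiffOn_motion : ContDiffOn ℝ 2 (fun p : Space × ℝ => motion p.1 p.2) (body ×ˢ times)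
  injOn_motion : ∀ t ∈ times, Set.InjOn (fun X => motion X t) body
  det_pos : ∀ X ∈ body, ∀ t ∈ times, 0 < (fderiv ℝ (fun Y => motion Y t) X).det

namespace Constituent

variable {times : Set ℝ} (C : Constituent times)

/-- The region of space engaged by the constituent at time `t`. -/
def region (t : ℝ) : Set Space := (fun X => C.motion X t) '' C.body

/-- The deformation gradient `F(X, t)`. -/
def defGrad (X : Space) (t : ℝ) : Tensor := fderiv ℝ (fun Y => C.motion Y t) X

/-- The velocity, as a function of the particle `X` and of time. -/
def refVelocity (X : Space) (t : ℝ) : Space := deriv (fun τ => C.motion X τ) t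

/-- The particle that is at the place `x` at time `t` (inverse of the configuration). -/
def particle (x : Space) (t : ℝ) : Space := Function.invFunOn (fun X => C.motion X t) C.body x

/-- The spatial velocity `v(x, t)`. -/
def velocity (x : Space) (t : ℝ) : Space := C.refVelocity (C.particle x t) t

/-- The bulk specific volume `φ = 1 / det F`, as a spatial field. -/
def bulkVolume (x : Space) (t : ℝ) : ℝ := 1 / (C.defGrad (C.particle x t) t).det

end Constituent

/-! ### Two-component mixtures -/

/-- A process of a mixture of a solid and a fluid whose free energy is ascribed to the solid. -/
structure Mixture where
  times : Set ℝ
  isOpen_times : IsOpen times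
  solid : Constituent times
  fluid : Constituent times
  /-- Wherever there is solid there is fluid. -/
  superposed : ∀ t ∈ times, solid.region t ⊆ fluid.region t
  /-- The free energy `Ψ_s(X, t)` of the solid per unit referential volume. -/
  refEnergy : Space → ℝ → ℝ
  contDiffOn_refEnergy :
    ContDiffOn ℝ 1 (fun p : Space × ℝ => refEnergy p.1 p.2) (solid.body ×ˢ times)
  /-- The partial Cauchy stress `T_s(x, t)` of the solid. -/
  solidStress : Space → ℝ → Tensor
  continuousOn_solidStress : ∀ t ∈ times, ContinuousOn (fun x => solidStress x t) (solid.region t)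
  /-- The pressure `λ(x, t)`. -/
  pressure : Space → ℝ → ℝ
  contDiffOn_pressure : ∀ t ∈ times, ContDiffOn ℝ 1 (fun x => pressure x t) (solid.region t)
  /-- The molar volume `v` of the fluid. -/
  molarVolume : ℝ
  molarVolume_pos : 0 < molarVolume

namespace Mixture

variable (M : Mixture)

/-- The spatial free energy density `ψ_s = φ_s Ψ_s`. -/
def energy (x : Space) (t : ℝ) : ℝ :=
  M.solid.bulkVolume x t * M.refEnergy (M.solid.particle x t) t

/-- The partial stress of the fluid, `T_f = - φ_f λ I`. -/
def fluidStress (x : Space) (t : ℝ) : Tensor :=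
  -(M.fluid.bulkVolume x t * M.pressure x t) • ContinuousLinearMap.id ℝ Space

/-- The total Cauchy stress `T = T_s + T_f`. -/
def stress (x : Space) (t : ℝ) : Tensor := M.solidStress x t + M.fluidStress x t

/-- The molar chemical potential of the fluid, `μ = v λ`. -/
def chemPotential (x : Space) (t : ℝ) : ℝ := M.molarVolume * M.pressure x t

/-- The molar flux of the fluid relative to the solid, `h = (φ_f / v) (v_f - v_s)`. -/
def flux (x : Space) (t : ℝ) : Space :=
  (M.fluid.bulkVolume x t / M.molarVolume) • (M.fluid.velocity x t - M.solid.velocity x t)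

/-- The referential (Piola) stress `T_R = (det F) T F⁻ᵀ`. -/
def refStress (X : Space) (t : ℝ) : Tensor :=
  (M.solid.defGrad X t).det •
    (M.stress (M.solid.motion X t) t ∘L
      ContinuousLinearMap.adjoint (ContinuousLinearMap.inverse (M.solid.defGrad X t)))

/-- The referential flux `h_R = (det F) F⁻¹ h`. -/
def refFlux (X : Space) (t : ℝ) : Space :=
  (M.solid.defGrad X t).det •
    ContinuousLinearMap.inverse (M.solid.defGrad X t) (M.flux (M.solid.motion X t) t)

/-- The dissipation inequality at time `t` for the fixed spatial region `Ω`: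
`d/dt ∫_Ω ψ_s + ∫_{∂Ω} ψ_s v_s · n ≤ ∫_Ω T · grad v_s - ∫_{∂Ω} μ h · n`,
where the time derivative is required to exist. -/
def SpatialDissipation (t : ℝ) (Ω : Set Space) : Prop :=
  ∃ D : ℝ, HasDerivAt (fun τ => ∫ x in Ω, M.energy x τ) D t ∧
    D + boundaryFlux Ω (fun x => M.energy x t • M.solid.velocity x t) ≤
      (∫ x in Ω, tensorInner (M.stress x t) (fderiv ℝ (fun y => M.solid.velocity y t) x)) -
        boundaryFlux Ω (fun x => M.chemPotential x t • M.flux x t)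

/-- The referential dissipation inequality at time `t` for the body part `P` of the solid:
`∫_P Ψ̇_s ≤ ∫_P T_R · Grad v_s - ∫_{∂P} μ h_R · n_R`. -/
def ReferentialDissipation (t : ℝ) (P : Set Space) : Prop :=
  (∫ X in P, deriv (fun τ => M.refEnergy X τ) t) ≤
    (∫ X in P, tensorInner (M.refStress X t) (fderiv ℝ (fun Y => M.solid.refVelocity Y t) X)) -
      boundaryFlux P (fun X => M.chemPotential (M.solid.motion X t) t • M.refFlux X t)

end Mixture

end Poro

end

/-!
Both dissipation inequalities are equivalent to the pointwise nonnegativity of one continuous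
field, the local dissipation `T · grad v_s - div (μ h) - (∂ψ_s/∂t + div (ψ_s v_s))`.

For a fixed spatial region this follows by differentiation under the integral sign and the
divergence theorem (`Mixture.spatialDissipation_iff`): the inequality says that the integral of the
local dissipation over the region is nonnegative. For a body part, three identities express the
referential densities by the spatial ones, each with the factor `J = det F`
(`Mixture.referentialDissipation_iff`): the stress power satisfies
`T_R · Grad v_s = J (T · grad v_s)`; the Piola identity, a consequence of Jacobi's formula and the symmetry of second
derivatives, gives `Div (μ h_R) = J div (μ h)`; and differentiating `ψ_s J = Ψ_s` along the motion,
with Euler's formula `dJ/dt = J div v_s`, gives the rate of `Ψ_s`. The referential inequality thus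
says that the integral of `J` times the local dissipation over the body part is nonnegative.
Testing on small balls, which are regular regions, turns either family of integral inequalities
into a pointwise one, and the two pointwise inequalities agree because `J > 0`. No change of
variables between a body part and the region that it occupies is needed.

The required smoothness of the spatial fields comes from the inverse function theorem for the
motion as a map of space-time (`Constituent.engaged_mem_nhds_and_contDiffAt_particle`).

The main tool is the divergence theorem on regular regions, whose boundary may have a compact
singular set of zero area (`IsRegularRegion.boundaryFlux_eq`). Near a regular boundary point the
region lies below the graph of a `C¹` function over the plane orthogonal to a direction `e`
transversal to the boundary, and the Gauss–Green formula in the direction `e` is Fubini's theorem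
along `e` together with the area formula for the graph, whose area factor is the reciprocal of
`n · e`. The directions in which the formula holds form a linear space, so it holds in all directions; a
partition of unity extends it to test functions supported away from the singular set. Finally, a
compact set of zero area is covered by finitely many balls with a small sum of squared radii, and
the corresponding cutoffs have gradients small in `L¹` (`exists_cutoff`), so that the singular set
does not contribute.
-/

namespace Poro

open Set Filter Module ENNReal

/-! ### The area formula for `C¹` immersions with a linear left inverse -/

/-- Area is controlled by distances: if `g` is `K`-Lipschitz relative to `h` on `A`, the
`d`-dimensional area of `g '' A` is at most `K ^ d` times that of `h '' A`. -/
theorem euclideanHausdorffMeasure_image_le_of_dist_le {ι X Y : Type*}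
    [PseudoEMetricSpace ι] [MetricSpace X] [MeasurableSpace X] [BorelSpace X]
    [MetricSpace Y] [MeasurableSpace Y] [BorelSpace Y] {g : ι → X} {h : ι → Y}
    {A : Set ι} {K : NNReal} (d : ℕ)
    (hgh : ∀ x ∈ A, ∀ y ∈ A, dist (g x) (g y) ≤ K * dist (h x) (h y)) :
    (μHE[d] : Measure X) (g '' A) ≤ (K : ℝ≥0∞) ^ d * (μHE[d] : Measure Y) (h '' A) := by
  rcases A.eq_empty_or_nonempty with rfl | ⟨a, ha⟩
  · simp
  have : Nonempty ι := ⟨a⟩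
  have hinv : ∀ x ∈ A, g (Function.invFunOn h A (h x)) = g x := fun x hx => by
    have h1 := Function.invFunOn_mem ⟨x, hx, rfl⟩ (f := h) (s := A) (b := h x)
    have h2 := Function.invFunOn_eq ⟨x, hx, rfl⟩ (f := h) (s := A) (b := h x)
    have := hgh _ h1 _ hx
    rw [h2, dist_self, mul_zero] at this
    exact dist_le_zero.1 this
  have himg : g '' A = (g ∘ Function.invFunOn h A) '' (h '' A) := by
    rw [image_image]
    exact image_congr fun x hx => (hinv x hx).symm
  have hlip : LipschitzOnWith K (g ∘ Function.invFunOn h A) (h '' A) := by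
    refine LipschitzOnWith.of_dist_le_mul ?_
    rintro _ ⟨x, hx, rfl⟩ _ ⟨y, hy, rfl⟩
    simp only [Function.comp_apply, hinv x hx, hinv y hy]
    exact hgh x hx y hy
  have key := hlip.hausdorffMeasure_image_le (d := d) (by positivity)
  rw [← himg, ENNReal.rpow_natCast] at key
  simp only [Measure.euclideanHausdorffMeasure_def, Measure.smul_apply, ENNReal.smul_def,
    smul_eq_mul]
  calc _ ≤ _ * ((K : ℝ≥0∞) ^ d * _) := by gcongr
    _ = _ := mul_left_comm _ _ _

/-- Measures can be compared locally: by second countability, a measurable set splits into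
countably many disjoint pieces on each of which the local comparison holds. -/
theorem measure_le_of_locally_le {X : Type*} [TopologicalSpace X] [SecondCountableTopology X]
    [MeasurableSpace X] [OpensMeasurableSpace X] {μ ν : Measure X} {D : Set X}
    (h : ∀ x ∈ D, ∃ N, IsOpen N ∧ x ∈ N ∧ ∀ A ⊆ N, A ⊆ D → MeasurableSet A → μ A ≤ ν A)
    {A : Set X} (hAD : A ⊆ D) (hA : MeasurableSet A) : μ A ≤ ν A := by
  rcases A.eq_empty_or_nonempty with rfl | ⟨a, ha⟩
  · simp
  choose! N hNo hxN hN using h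
  obtain ⟨t, htD, htc, htU⟩ := TopologicalSpace.countable_cover_nhdsWithin (s := D) (f := N)
    fun x hx => mem_nhdsWithin_of_mem_nhds ((hNo x hx).mem_nhds (hxN x hx))
  have htne : t.Nonempty := by
    obtain ⟨x, hx, -⟩ := mem_iUnion₂.1 (htU (hAD ha))
    exact ⟨x, hx⟩
  obtain ⟨f, rfl⟩ := htc.exists_eq_range htne
  have hfD : ∀ n, f n ∈ D := fun n => htD (mem_range_self n)
  have hcov : A = ⋃ n, A ∩ disjointed (fun n => N (f n)) n := by
    rw [← inter_iUnion, iUnion_disjointed, eq_comm, inter_eq_left]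
    refine (hAD.trans htU).trans ?_
    simp
  have hmeas : ∀ n, MeasurableSet (A ∩ disjointed (fun n => N (f n)) n) := fun n =>
    hA.inter (.disjointed (fun n => (hNo _ (hfD n)).measurableSet) n)
  have hdisj : Pairwise (Function.onFun Disjoint
      fun n => A ∩ disjointed (fun n => N (f n)) n) := fun i j hij =>
    (disjoint_disjointed _ hij).mono inter_subset_right inter_subset_right
  rw [hcov, measure_iUnion hdisj hmeas, measure_iUnion hdisj hmeas]
  exact ENNReal.tsum_le_tsum fun n => hN _ (hfD n) _
    (inter_subset_right.trans (disjointed_subset _ n)) (inter_subset_left.trans hAD) (hmeas n)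

section Area

variable {E F : Type*} [NormedAddCommGroup E] [InnerProductSpace ℝ E] [FiniteDimensional ℝ E]
  [NormedAddCommGroup F] [InnerProductSpace ℝ F]

theorem continuous_normDet [FiniteDimensional ℝ F] :
    Continuous fun L : E →L[ℝ] F => L.toLinearMap.normDet := by
  have h : (fun L : E →L[ℝ] F => L.toLinearMap.normDet) =
      fun L : E →L[ℝ] F => √(ContinuousLinearMap.adjoint L ∘L L).det := by
    ext L
    have := L.normDet_sq
    rw [← this]
    simp [Real.sqrt_sq (LinearMap.normDet_nonneg _)]
  rw [h]
  refine Real.continuous_sqrt.comp (ContinuousLinearMap.continuous_det.comp ?_)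
  exact (ContinuousLinearMap.adjoint.continuous).clm_comp continuous_id

theorem normDet_pos_of_norm_le {L : E →L[ℝ] F} (hL : ∀ v, ‖v‖ ≤ ‖L v‖) :
    0 < L.toLinearMap.normDet := by
  refine (LinearMap.normDet_nonneg _).lt_of_ne' fun h => ?_
  rw [LinearMap.normDet_eq_zero_iff_ker_ne_bot] at h
  refine h ((Submodule.eq_bot_iff _).2 fun v hv => ?_)
  have := hL v
  rw [LinearMap.mem_ker] at hv
  change L v = 0 at hv
  simpa [hv] using this

variable [MeasurableSpace E] [BorelSpace E] [MeasurableSpace F] [BorelSpace F]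

/-- Near a point where `G` has an expanding strict derivative `L`, the map `G` is a
`(1 + ε)`-bilipschitz deformation of the linear map `L`, so that it changes areas by the factor
`normDet L` up to `(1 + ε) ^ d`. -/
theorem exists_nhds_area_image_bounds {G : E → F} {L : E →L[ℝ] F} {y : E}
    (hG : HasStrictFDerivAt G L y) (hL : ∀ v, ‖v‖ ≤ ‖L v‖) {ε : ℝ} (hε : 0 < ε) (hε1 : ε < 1) :
    ∃ N ∈ 𝓝 y, (∀ A ⊆ N,
      μHE[finrank ℝ E] (G '' A) ≤ .ofReal ((1 + ε) ^ finrank ℝ E) *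
        (.ofReal L.toLinearMap.normDet * volume A) ∧
      .ofReal L.toLinearMap.normDet * volume A ≤ .ofReal ((1 + ε) ^ finrank ℝ E) *
        μHE[finrank ℝ E] (G '' A)) := by
  -- `δ` is chosen so that `(1 - δ)⁻¹ = 1 + ε`.
  obtain ⟨δ, hδ, hδε, hδe⟩ : ∃ δ : ℝ, 0 < δ ∧ δ ≤ ε ∧ 1 ≤ (1 + ε) * (1 - δ) := by
    refine ⟨ε / (1 + ε), by positivity, ?_, ?_⟩
    · exact div_le_self hε.le (by linarith)
    · have : 1 - ε / (1 + ε) = 1 / (1 + ε) := by field_simp; ring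
      rw [this]; field_simp; exact le_rfl
  obtain ⟨N, hN, hNG⟩ := hG.approximates_deriv_on_nhds (c := ⟨δ, hδ.le⟩) (Or.inr hδ)
  have key : ∀ x ∈ N, ∀ z ∈ N, ‖G x - G z - L (x - z)‖ ≤ δ * ‖L (x - z)‖ := fun x hx z hz =>
    (hNG x hx z hz).trans (mul_le_mul_of_nonneg_left (hL _) hδ.le)
  have hK : ((Real.toNNReal (1 + ε) : NNReal) : ℝ≥0∞) ^ finrank ℝ E =
      .ofReal ((1 + ε) ^ finrank ℝ E) := by
    rw [← ENNReal.ofReal, ENNReal.ofReal_pow (by positivity)]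
  have hlin : ∀ A : Set E, μHE[finrank ℝ E] (L '' A) = .ofReal L.toLinearMap.normDet * volume A :=
    fun A => L.toLinearMap.euclideanHausdorffMeasure_image_eq_normDet_mul_volume A
  refine ⟨N, hN, fun A hA => ⟨?_, ?_⟩⟩
  · rw [← hlin, ← hK]
    refine euclideanHausdorffMeasure_image_le_of_dist_le _ fun x hx z hz => ?_
    rw [dist_eq_norm, dist_eq_norm, ← map_sub, Real.coe_toNNReal _ (by positivity)]
    have h1 := key x (hA hx) z (hA hz)
    have h2 := norm_le_norm_add_norm_sub' (G x - G z) (L (x - z))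
    nlinarith [norm_nonneg (L (x - z))]
  · rw [← hlin, ← hK]
    refine euclideanHausdorffMeasure_image_le_of_dist_le _ fun x hx z hz => ?_
    rw [dist_eq_norm, dist_eq_norm, ← map_sub, Real.coe_toNNReal _ (by positivity)]
    have h1 := key x (hA hx) z (hA hz)
    have h2 := norm_le_norm_add_norm_sub (G x - G z) (L (x - z))
    have h3 : (1 - δ) * ‖L (x - z)‖ ≤ ‖G x - G z‖ := by linarith
    calc ‖L (x - z)‖ ≤ (1 + ε) * (1 - δ) * ‖L (x - z)‖ :=
          le_mul_of_one_le_left (norm_nonneg _) hδe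
      _ = (1 + ε) * ((1 - δ) * ‖L (x - z)‖) := by ring
      _ ≤ _ := by gcongr

/-- The area formula. Let `G` be of class `C¹` on the open set `D`, with a linear left inverse `P`
of norm at most one. The area of the surface `G '' D`, transported to `D` by `P`, has density
`normDet (fderiv ℝ G)` with respect to the Lebesgue measure. -/
theorem map_euclideanHausdorffMeasure_restrict_image [FiniteDimensional ℝ F]
    {G : E → F} {D : Set E} (hD : IsOpen D)
    (hG : ContDiffOn ℝ 1 G D) (P : F →L[ℝ] E) (hP : ∀ v, ‖P v‖ ≤ ‖v‖)
    (hPG : ∀ y ∈ D, P (G y) = y) :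
    Measure.map P ((μHE[finrank ℝ E] : Measure F).restrict (G '' D)) =
      (volume.restrict D).withDensity
        fun y => .ofReal (fderiv ℝ G y).toLinearMap.normDet := by
  set m := Measure.map P ((μHE[finrank ℝ E] : Measure F).restrict (G '' D)) with hm
  set l := (volume.restrict D).withDensity
        fun y => ENNReal.ofReal (fderiv ℝ G y).toLinearMap.normDet with hl
  have hstrict : ∀ y ∈ D, HasStrictFDerivAt G (fderiv ℝ G y) y := fun y hy =>
    (hG.contDiffAt (hD.mem_nhds hy)).hasStrictFDerivAt one_ne_zero
  have hexp : ∀ y ∈ D, ∀ v, ‖v‖ ≤ ‖fderiv ℝ G y v‖ := fun y hy v => by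
    have h1 : HasFDerivAt (fun z => P (G z)) (P ∘L fderiv ℝ G y) y :=
      P.hasFDerivAt.comp y (hstrict y hy).hasFDerivAt
    have h2 : HasFDerivAt (fun z => P (G z)) (ContinuousLinearMap.id ℝ E) y :=
      (hasFDerivAt_id y).congr_of_eventuallyEq (by
        filter_upwards [hD.mem_nhds hy] with z hz using hPG z hz)
    have h3 : P (fderiv ℝ G y v) = v := congr($(h1.unique h2) v)
    calc ‖v‖ = ‖P (fderiv ℝ G y v)‖ := by rw [h3]
      _ ≤ _ := hP _
  have hJc : ContinuousOn (fun y => (fderiv ℝ G y).toLinearMap.normDet) D :=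
    continuous_normDet.comp_continuousOn (hG.continuousOn_fderiv_of_isOpen hD le_rfl)
  have hmA : ∀ A ⊆ D, MeasurableSet A → m A = μHE[finrank ℝ E] (G '' A) := fun A hAD hA => by
    rw [hm, Measure.map_apply P.continuous.measurable hA,
      Measure.restrict_apply (P.continuous.measurable hA)]
    congr 1
    ext x
    constructor
    · rintro ⟨hx, y, hy, rfl⟩
      rw [mem_preimage, hPG y hy] at hx
      exact ⟨y, hx, rfl⟩
    · rintro ⟨y, hy, rfl⟩
      exact ⟨by rwa [mem_preimage, hPG y (hAD hy)], y, hAD hy, rfl⟩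
  have hlA : ∀ A ⊆ D, MeasurableSet A →
      l A = ∫⁻ y in A, .ofReal (fderiv ℝ G y).toLinearMap.normDet := fun A hAD hA => by
    rw [hl, withDensity_apply _ hA, Measure.restrict_restrict hA, inter_eq_left.2 hAD]
  -- The local comparison, with a factor tending to one.
  have hloc : ∀ ε : ℝ, 0 < ε → ε < 1 → ∀ y ∈ D, ∃ N, IsOpen N ∧ y ∈ N ∧ ∀ A ⊆ N, A ⊆ D →
      MeasurableSet A → m A ≤ (ENNReal.ofReal ((1 + ε) ^ (finrank ℝ E + 1)) • l) A ∧
        l A ≤ (ENNReal.ofReal ((1 + ε) ^ (finrank ℝ E + 1)) • m) A := by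
    intro ε hε hε1 y hy
    have hJ := normDet_pos_of_norm_le (hexp y hy)
    set J := (fderiv ℝ G y).toLinearMap.normDet
    obtain ⟨N, hN, hNA⟩ := exists_nhds_area_image_bounds (hstrict y hy) (hexp y hy) hε hε1
    have hnear : ∀ᶠ z in 𝓝 y, J ≤ (1 + ε) * (fderiv ℝ G z).toLinearMap.normDet ∧
        (fderiv ℝ G z).toLinearMap.normDet ≤ (1 + ε) * J := by
      have hc := hJc.continuousAt (hD.mem_nhds hy)
      have h1 : ∀ᶠ z in 𝓝 y, (fderiv ℝ G z).toLinearMap.normDet < (1 + ε) * J :=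
        hc.eventually_lt_const (by change J < _; nlinarith)
      have h2 : ∀ᶠ z in 𝓝 y, J < (1 + ε) * (fderiv ℝ G z).toLinearMap.normDet :=
        (hc.const_mul (1 + ε)).eventually_const_lt (by change J < (1 + ε) * J; nlinarith)
      filter_upwards [h1, h2] with z h1 h2 using ⟨h2.le, h1.le⟩
    obtain ⟨N', hN', hN'o, hyN'⟩ := mem_nhds_iff.1 (inter_mem hN hnear)
    refine ⟨N', hN'o, hyN', fun A hAN hAD hA => ?_⟩
    obtain ⟨b1, b2⟩ := hNA A fun z hz => (hN' (hAN hz)).1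
    have hup : ENNReal.ofReal J * volume A ≤ .ofReal (1 + ε) * l A := by
      rw [hlA A hAD hA, ← setLIntegral_const, ← lintegral_const_mul' _ _ ofReal_ne_top]
      refine setLIntegral_mono' hA fun z hz => ?_
      rw [← ENNReal.ofReal_mul (by positivity)]
      exact ENNReal.ofReal_le_ofReal (hN' (hAN hz)).2.1
    have hlo : l A ≤ .ofReal (1 + ε) * (ENNReal.ofReal J * volume A) := by
      rw [hlA A hAD hA, ← setLIntegral_const, ← lintegral_const_mul' _ _ ofReal_ne_top]
      refine setLIntegral_mono' hA fun z hz => ?_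
      rw [← ENNReal.ofReal_mul (by positivity)]
      exact ENNReal.ofReal_le_ofReal (hN' (hAN hz)).2.2
    have hpow : ENNReal.ofReal ((1 + ε) ^ (finrank ℝ E + 1)) =
        .ofReal ((1 + ε) ^ finrank ℝ E) * .ofReal (1 + ε) := by
      rw [pow_succ, ENNReal.ofReal_mul (by positivity)]
    simp only [Measure.smul_apply, smul_eq_mul, hpow]
    constructor
    · rw [hmA A hAD hA, mul_assoc]
      exact b1.trans (by gcongr)
    · rw [hmA A hAD hA, mul_comm (ENNReal.ofReal ((1 + ε) ^ finrank ℝ E)), mul_assoc]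
      exact hlo.trans (by gcongr)
  have hlim : ∀ a : ℝ≥0∞, Tendsto (fun ε : ℝ => ENNReal.ofReal ((1 + ε) ^ (finrank ℝ E + 1)) * a)
      (𝓝[>] 0) (𝓝 a) := fun a => by
    have h0 : Tendsto (fun ε : ℝ => ENNReal.ofReal ((1 + ε) ^ (finrank ℝ E + 1)))
        (𝓝[>] 0) (𝓝 1) := by
      have : Continuous fun ε : ℝ => ENNReal.ofReal ((1 + ε) ^ (finrank ℝ E + 1)) :=
        ENNReal.continuous_ofReal.comp (by fun_prop)
      simpa using (this.tendsto 0).mono_left nhdsWithin_le_nhds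
    simpa using ENNReal.Tendsto.mul_const (b := a) h0 (Or.inl one_ne_zero)
  have hev : ∀ᶠ ε : ℝ in 𝓝[>] 0, 0 < ε ∧ ε < 1 :=
    Ioo_mem_nhdsGT one_pos
  have hDA : ∀ A ⊆ D, MeasurableSet A → m A = l A := fun A hAD hA => by
    refine le_antisymm (ge_of_tendsto (hlim (l A)) ?_) (ge_of_tendsto (hlim (m A)) ?_)
    · filter_upwards [hev] with ε hε
      refine measure_le_of_locally_le (fun y hy => ?_) hAD hA (ν := ENNReal.ofReal _ • l)
      obtain ⟨N, h1, h2, h3⟩ := hloc ε hε.1 hε.2 y hy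
      exact ⟨N, h1, h2, fun B b1 b2 b3 => (h3 B b1 b2 b3).1⟩
    · filter_upwards [hev] with ε hε
      refine measure_le_of_locally_le (fun y hy => ?_) hAD hA (ν := ENNReal.ofReal _ • m)
      obtain ⟨N, h1, h2, h3⟩ := hloc ε hε.1 hε.2 y hy
      exact ⟨N, h1, h2, fun B b1 b2 b3 => (h3 B b1 b2 b3).2⟩
  ext A hA
  have hm0 : m A = m (A ∩ D) := by
    rw [hm, Measure.map_apply P.continuous.measurable hA,
      Measure.map_apply P.continuous.measurable (hA.inter hD.measurableSet),
      Measure.restrict_apply (P.continuous.measurable hA),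
      Measure.restrict_apply (P.continuous.measurable (hA.inter hD.measurableSet))]
    congr 1
    ext x
    simp only [mem_inter_iff, mem_preimage]
    constructor
    · rintro ⟨hx, y, hy, rfl⟩
      exact ⟨⟨hx, by rwa [hPG y hy]⟩, y, hy, rfl⟩
    · rintro ⟨hx, hy⟩
      exact ⟨hx.1, hy⟩
  have hl0 : l A = l (A ∩ D) := by
    rw [hl, withDensity_apply _ hA, withDensity_apply _ (hA.inter hD.measurableSet),
      Measure.restrict_restrict hA, Measure.restrict_restrict (hA.inter hD.measurableSet),
      inter_assoc, inter_self]
  rw [hm0, hl0, hDA _ inter_subset_right (hA.inter hD.measurableSet)]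

end Area

/-! ### Orthogonal coordinates along a direction -/

/-- The plane through the origin orthogonal to `e`. -/
noncomputable abbrev plane (e : Space) : Submodule ℝ Space := (ℝ ∙ e)ᗮ

/-- The orthogonal projection onto the plane orthogonal to `e`. -/
noncomputable abbrev planeProj (e : Space) : Space →L[ℝ] plane e :=
  (plane e).orthogonalProjectionOnto

theorem finrank_plane {e : Space} (he : ‖e‖ = 1) : finrank ℝ (plane e) = 2 := by
  have : Fact (finrank ℝ Space = 2 + 1) := ⟨by simp⟩
  exact Submodule.finrank_orthogonal_span_singleton (by rintro rfl; simp at he)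

theorem inner_plane (e : Space) (w : plane e) : inner ℝ e (w : Space) = 0 :=
  Submodule.mem_orthogonal_singleton_iff_inner_right.1 w.2

theorem inner_plane_left (e : Space) (w : plane e) : inner ℝ (w : Space) e = 0 :=
  Submodule.mem_orthogonal_singleton_iff_inner_left.1 w.2

theorem planeProj_add_inner_smul {e : Space} (he : ‖e‖ = 1) (x : Space) :
    (planeProj e x : Space) + inner ℝ e x • e = x := by
  have h := Submodule.starProjection_add_starProjection_orthogonal (K := ℝ ∙ e) x
  rw [Submodule.starProjection_unit_singleton ℝ he, Submodule.starProjection_apply] at h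
  rw [add_comm]
  exact h

theorem planeProj_coe_add_smul (e : Space) (w : plane e) (s : ℝ) :
    planeProj e ((w : Space) + s • e) = w := by
  rw [map_add, map_smul, Submodule.orthogonalProjectionOnto_orthogonalComplement_singleton_eq_zero,
    smul_zero, add_zero, Submodule.orthogonalProjectionOnto_mem_subspace_eq_self]

theorem inner_coe_add_smul {e : Space} (he : ‖e‖ = 1) (w : plane e) (s : ℝ) :
    inner ℝ e ((w : Space) + s • e) = s := by
  rw [inner_add_right, inner_plane, inner_smul_right, real_inner_self_eq_norm_sq, he]
  simp

/-- Orthogonal coordinates: a point `x` is written as `w + s e` with `w` orthogonal to `e`. -/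
noncomputable def coordEquiv {e : Space} (he : ‖e‖ = 1) : (plane e × ℝ) ≃ᵐ Space where
  toFun p := (p.1 : Space) + p.2 • e
  invFun x := (planeProj e x, inner ℝ e x)
  left_inv p := Prod.ext (planeProj_coe_add_smul e _ _) (inner_coe_add_smul he _ _)
  right_inv x := planeProj_add_inner_smul he x
  measurable_toFun := by
    refine Continuous.measurable ?_
    change Continuous fun p : plane e × ℝ => (p.1 : Space) + p.2 • e
    fun_prop
  measurable_invFun := by
    refine Continuous.measurable ?_
    change Continuous fun x : Space => (planeProj e x, inner ℝ e x)
    fun_prop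

theorem measurePreserving_coordEquiv {e : Space} (he : ‖e‖ = 1) :
    MeasurePreserving (coordEquiv he) := by
  have h1 := ((ℝ ∙ e).measurePreserving_measurableEquivProd (0 : Space)).symm
  rw [InnerProductSpace.euclideanHausdorffMeasure_eq_volume] at h1
  have h2 : MeasurePreserving (fun p : plane e × ℝ =>
      ((LinearIsometryEquiv.toSpanUnitSingleton (𝕜 := ℝ) e he p.2, p.1) :
        (ℝ ∙ e : Submodule ℝ Space) × plane e)) := by
    have h3 := (LinearIsometryEquiv.toSpanUnitSingleton (𝕜 := ℝ) e he).measurePreserving.prod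
      (MeasurePreserving.id (volume : Measure (plane e)))
    exact h3.comp (Measure.measurePreserving_swap (μ := (volume : Measure (plane e)))
      (ν := (volume : Measure ℝ)))
  convert! h1.comp h2 using 1
  ext p : 1
  simp [coordEquiv, add_comm]

/-- The area factor of the graph of a function with differential `l` over the plane orthogonal to
`e`, expressed by a normal vector `N` of the tangent plane of the graph. -/
theorem normDet_graph {e N : Space} (he : ‖e‖ = 1) (hN : 0 < inner ℝ N e) {l : plane e →L[ℝ] ℝ}
    (hl : ∀ v : plane e, inner ℝ N (v : Space) + l v * inner ℝ N e = 0) :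
    ((plane e).subtypeL + l.smulRight e).toLinearMap.normDet = ‖N‖ / inner ℝ N e := by
  set L := (plane e).subtypeL + l.smulRight e
  have hLv : ∀ v, L v = (v : Space) + l v • e := fun v => rfl
  set c := inner ℝ N e with hc
  -- The gradient of the graphing function.
  set g : plane e := -c⁻¹ • planeProj e N with hg
  have hlg : ∀ v, l v = inner ℝ g v := fun v => by
    have h1 : inner ℝ N (v : Space) = inner ℝ (planeProj e N) v :=
      (Submodule.inner_orthogonalProjectionOnto_eq_of_mem_right v N).symm
    have h2 := hl v
    rw [hg, inner_smul_left, ← h1]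
    simp only [map_neg, map_inv₀, conj_trivial]
    field_simp
    linarith
  have hsq : L.toLinearMap.normDet ^ 2 = 1 + l g := by
    have h := L.normDet_sq
    have h' : ((ContinuousLinearMap.adjoint L ∘L L : plane e →L[ℝ] plane e) :
        plane e →ₗ[ℝ] plane e) = LinearMap.transvection l.toLinearMap g := by
      ext1 v
      refine ext_inner_right ℝ fun w => ?_
      change inner ℝ (ContinuousLinearMap.adjoint L (L v)) w = inner ℝ (v + l v • g) w
      rw [ContinuousLinearMap.adjoint_inner_left, hLv, hLv, inner_add_left, inner_add_right,
        inner_add_right, inner_smul_left, inner_smul_left, inner_smul_right, inner_smul_right,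
        inner_plane, inner_plane_left, real_inner_self_eq_norm_sq, he, inner_add_left,
        inner_smul_left, ← hlg w]
      simp
    rw [ContinuousLinearMap.det, h', LinearMap.transvection.det] at h
    exact h
  have hgg : l g = ‖planeProj e N‖ ^ 2 / c ^ 2 := by
    rw [hlg, hg, real_inner_self_eq_norm_sq, norm_smul, mul_pow, norm_neg, norm_inv,
      Real.norm_eq_abs, inv_pow, sq_abs]
    ring
  have hNN : ‖N‖ ^ 2 = ‖planeProj e N‖ ^ 2 + c ^ 2 := by
    conv_lhs => rw [← planeProj_add_inner_smul he N]
    rw [← real_inner_self_eq_norm_sq, inner_add_left, inner_add_right, inner_add_right,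
      inner_smul_left, inner_smul_left, inner_smul_right, inner_smul_right, inner_plane,
      inner_plane_left, real_inner_self_eq_norm_sq e, he, ← Submodule.coe_inner,
      real_inner_self_eq_norm_sq, hc, real_inner_comm e N]
    simp
    ring
  refine (pow_left_inj₀ (LinearMap.normDet_nonneg _) (by positivity) two_ne_zero).1 ?_
  rw [hsq, hgg, div_pow, hNN]
  field_simp
  ring

/-- Implicit function theorem: where the derivative of `ρ` in the direction `e` is positive, the
set `{ρ < 0}` lies below, and the set `{ρ = 0}` is, the graph of a `C¹` function in the orthogonal
coordinates along `e`. -/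
theorem exists_graph_chart {e x₀ : Space} (he : ‖e‖ = 1) {ρ : Space → ℝ} {U : Set Space}
    (hU : IsOpen U) (hx₀ : x₀ ∈ U) (hρ : ContDiffOn ℝ 1 ρ U) (h0 : ρ x₀ = 0)
    (hpos : 0 < fderiv ℝ ρ x₀ e) :
    ∃ (D : Set (plane e)) (a b : ℝ) (f : plane e → ℝ), IsOpen D ∧ planeProj e x₀ ∈ D ∧
      inner ℝ e x₀ ∈ Ioo a b ∧ ContDiffOn ℝ 1 f D ∧ ∀ w ∈ D, f w ∈ Ioo a b ∧
        ∀ s ∈ Ioo a b, (w : Space) + s • e ∈ U ∧ 0 < fderiv ℝ ρ ((w : Space) + s • e) e ∧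
          (ρ ((w : Space) + s • e) < 0 ↔ s < f w) ∧ (ρ ((w : Space) + s • e) = 0 ↔ s = f w) := by
  set T : plane e × ℝ →L[ℝ] Space :=
    ((plane e).subtypeL.comp (.fst ℝ _ _)) + (ContinuousLinearMap.snd ℝ (plane e) ℝ).smulRight e
    with hT
  have hTv : ∀ v, T v = (v.1 : Space) + v.2 • e := fun v => rfl
  set u : plane e × ℝ := (planeProj e x₀, inner ℝ e x₀) with hu
  have hTu : T u = x₀ := planeProj_add_inner_smul he x₀
  have hFd : ContDiffAt ℝ 1 (fun v => ρ (T v)) u :=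
    ContDiffAt.comp u (by rw [hTu]; exact hρ.contDiffAt (hU.mem_nhds hx₀)) T.contDiff.contDiffAt
  have hfd : ∀ v, T v ∈ U → HasFDerivAt (fun v => ρ (T v)) (fderiv ℝ ρ (T v) ∘L T) v := fun v hv =>
    HasFDerivAt.comp v ((hρ.contDiffAt (hU.mem_nhds hv)).differentiableAt one_ne_zero).hasFDerivAt
      T.hasFDerivAt
  have hinv : (fderiv ℝ (fun v => ρ (T v)) u ∘L .inr ℝ (plane e) ℝ).IsInvertible := by
    refine ⟨ContinuousLinearEquiv.unitsEquivAut ℝ (Units.mk0 _ hpos.ne'), ?_⟩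
    ext
    rw [(hfd u (by rwa [hTu])).fderiv, hTu]
    simp [hTv]
  set f := hFd.implicitFunction one_ne_zero hinv
  have hfc : ContDiffAt ℝ 1 f u.1 := hFd.contDiffAt_implicitFunction one_ne_zero hinv
  have hfu : f u.1 = u.2 := hFd.implicitFunction_apply_self one_ne_zero hinv
  have hf0 : ∀ᶠ w in 𝓝 u.1, ρ (T (w, f w)) = 0 := by
    filter_upwards [hFd.eventually_apply_implicitFunction one_ne_zero hinv] with w hw
    rw [hw, hTu, h0]
  -- A product neighbourhood on which the derivative along `e` stays positive.
  have hS : {v : plane e × ℝ | T v ∈ U ∧ 0 < fderiv ℝ ρ (T v) e} ∈ 𝓝 u := by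
    have h1 : {x | x ∈ U ∧ 0 < fderiv ℝ ρ x e} ∈ 𝓝 (T u) := by
      rw [hTu]
      have hc : ContinuousAt (fun x => fderiv ℝ ρ x e) x₀ :=
        ((hρ.continuousOn_fderiv_of_isOpen hU le_rfl).continuousAt (hU.mem_nhds hx₀)).clm_apply
          continuousAt_const
      filter_upwards [hU.mem_nhds hx₀, hc.eventually_const_lt hpos] with x h1 h2 using ⟨h1, h2⟩
    exact T.continuous.continuousAt h1
  obtain ⟨r, hr, hball⟩ := Metric.mem_nhds_iff.1 hS
  have hIoo : ∀ᶠ w in 𝓝 u.1, f w ∈ Ioo (u.2 - r) (u.2 + r) :=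
    hfc.continuousAt.eventually_mem (by rw [hfu]; exact Ioo_mem_nhds (by linarith) (by linarith))
  obtain ⟨D, hD, hDo, huD⟩ := eventually_nhds_iff.1
    ((hf0.and hIoo).and ((hfc.eventually (by simp)).and (Metric.ball_mem_nhds u.1 hr)))
  refine ⟨D, u.2 - r, u.2 + r, f, hDo, huD, ⟨by simp [hu, hr], by simp [hu, hr]⟩,
    fun w hw => (hD w hw).2.1.contDiffWithinAt, fun w hw => ⟨(hD w hw).1.2, ?_⟩⟩
  have hmem : ∀ s ∈ Ioo (u.2 - r) (u.2 + r), T (w, s) ∈ U ∧ 0 < fderiv ℝ ρ (T (w, s)) e := by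
    intro s hs
    refine hball ?_
    rw [← ball_prod_same]
    exact ⟨(hD w hw).2.2, by rw [Real.ball_eq_Ioo]; exact hs⟩
  have hder : ∀ s ∈ Ioo (u.2 - r) (u.2 + r),
      HasDerivAt (fun s => ρ (T (w, s))) (fderiv ℝ ρ (T (w, s)) e) s := fun s hs => by
    have h1 : HasDerivAt (fun s => T (w, s)) e s := by
      simp only [hTv]
      simpa using ((hasDerivAt_id s).smul_const e).const_add (w : Space)
    exact HasFDerivAt.comp_hasDerivAt s
      ((hρ.contDiffAt (hU.mem_nhds (hmem s hs).1)).differentiableAt one_ne_zero).hasFDerivAt h1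
  have hmono : StrictMonoOn (fun s => ρ (T (w, s))) (Ioo (u.2 - r) (u.2 + r)) := by
    refine strictMonoOn_of_deriv_pos (convex_Ioo _ _)
      (fun s hs => (hder s hs).continuousAt.continuousWithinAt) fun s hs => ?_
    rw [interior_Ioo] at hs
    rw [(hder s hs).deriv]
    exact (hmem s hs).2
  intro s hs
  refine ⟨(hmem s hs).1, (hmem s hs).2, ?_, ?_⟩
  · have := hmono.lt_iff_lt hs (hD w hw).1.2
    rw [(hD w hw).1.1] at this
    exact this
  · have := hmono.injOn.eq_iff hs (hD w hw).1.2
    rw [(hD w hw).1.1] at this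
    exact this

/-! ### Outward unit normals and charts of the boundary -/

theorem continuousAt_gradient {ρ : Space → ℝ} {U : Set Space} (hU : IsOpen U)
    (hρ : ContDiffOn ℝ 1 ρ U) {x : Space} (hx : x ∈ U) : ContinuousAt (∇ ρ) x := by
  have h := (hρ.continuousOn_fderiv_of_isOpen hU le_rfl).continuousAt (hU.mem_nhds hx)
  exact (InnerProductSpace.toDual ℝ Space).symm.continuous.continuousAt.comp h

theorem eventually_lt_zero_of_fderiv_neg {ρ : Space → ℝ} {x d : Space} (hρ : DifferentiableAt ℝ ρ x)
    (h0 : ρ x = 0) (hd : fderiv ℝ ρ x d < 0) : ∀ᶠ t : ℝ in 𝓝[>] 0, ρ (x + t • d) < 0 := by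
  have h1 : HasDerivAt (fun t : ℝ => ρ (x + t • d)) (fderiv ℝ ρ x d) 0 := by
    have h2 : HasDerivAt (fun t : ℝ => x + t • d) d 0 := by
      simpa using ((hasDerivAt_id (0 : ℝ)).smul_const d).const_add x
    have h3 : HasFDerivAt ρ (fderiv ℝ ρ x) (x + (0 : ℝ) • d) := by
      simpa using hρ.hasFDerivAt
    exact h3.comp_hasDerivAt 0 h2
  have h4 := (hasDerivAt_iff_tendsto_slope_zero.1 h1).mono_left (nhdsGT_le_nhdsNE 0)
  filter_upwards [h4.eventually_lt_const hd, self_mem_nhdsWithin] with t ht ht0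
  have ht0 : (0 : ℝ) < t := ht0
  simp only [zero_add, zero_smul, add_zero, h0, sub_zero, smul_eq_mul] at ht
  by_contra hcon
  exact absurd ht (not_lt.2 (mul_nonneg (inv_nonneg.2 ht0.le) (not_lt.1 hcon)))

/-- The outward unit normal does not depend on the defining function: if two unit normals `n`, `n'`
differed, the direction `n' - n` would point into the set by the first defining function and out of
it by the second. -/
theorem IsOutwardUnitNormal.unique {Ω : Set Space} {x n n' : Space}
    (h : IsOutwardUnitNormal Ω x n) (h' : IsOutwardUnitNormal Ω x n') : n = n' := by
  obtain ⟨U, ρ, hU, hxU, hρ, h0, hne, hΩ, hn⟩ := h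
  obtain ⟨U', ρ', hU', hxU', hρ', h0', hne', hΩ', hn'⟩ := h'
  by_contra hnn
  have hn1 : ‖n‖ = 1 := by rw [hn, norm_smul, norm_inv, norm_norm, inv_mul_cancel₀ (by simpa)]
  have hn1' : ‖n'‖ = 1 := by
    rw [hn', norm_smul, norm_inv, norm_norm, inv_mul_cancel₀ (by simpa)]
  have hlt : inner ℝ n n' < 1 := by
    refine lt_of_le_of_ne ?_ fun h => hnn ((inner_eq_one_iff_of_norm_eq_one hn1 hn1').1 h)
    simpa [hn1, hn1'] using real_inner_le_norm n n'
  have hgr : ∇ ρ x = ‖∇ ρ x‖ • n := by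
    rw [hn, smul_smul, mul_inv_cancel₀ (by simpa), one_smul]
  have hgr' : ∇ ρ' x = ‖∇ ρ' x‖ • n' := by
    rw [hn', smul_smul, mul_inv_cancel₀ (by simpa), one_smul]
  have hd : fderiv ℝ ρ x (n' - n) < 0 := by
    rw [← inner_gradient_left, hgr, inner_smul_left, inner_sub_right, real_inner_self_eq_norm_sq,
      hn1]
    exact mul_neg_of_pos_of_neg (by simpa using hne) (by linarith)
  have hd' : fderiv ℝ (fun y => -ρ' y) x (n' - n) < 0 := by
    rw [fderiv_fun_neg, neg_apply, ← inner_gradient_left, hgr',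
      inner_smul_left, inner_sub_right, real_inner_self_eq_norm_sq, hn1', real_inner_comm n n',
      neg_lt_zero]
    exact mul_pos (by simpa using hne') (by linarith)
  have e1 := eventually_lt_zero_of_fderiv_neg
    ((hρ.contDiffAt (hU.mem_nhds hxU)).differentiableAt one_ne_zero) h0 hd
  have e2 := eventually_lt_zero_of_fderiv_neg (ρ := fun y => -ρ' y)
    ((hρ'.contDiffAt (hU'.mem_nhds hxU')).differentiableAt one_ne_zero).neg (by simp [h0']) hd'
  have e3 : ∀ᶠ t : ℝ in 𝓝[>] 0, x + t • (n' - n) ∈ U ∩ U' := by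
    have hc : Continuous fun t : ℝ => x + t • (n' - n) := by fun_prop
    refine (hc.continuousAt.eventually_mem ?_).filter_mono nhdsWithin_le_nhds
    simpa using inter_mem (hU.mem_nhds hxU) (hU'.mem_nhds hxU')
  obtain ⟨t, ⟨t1, t2⟩, t3⟩ := ((e1.and e2).and e3).exists
  have m1 : x + t • (n' - n) ∈ Ω ∩ U := by rw [hΩ]; exact ⟨t3.1, t1⟩
  have m2 : x + t • (n' - n) ∈ Ω ∩ U' := ⟨m1.1, t3.2⟩
  rw [hΩ'] at m2
  linarith [m2.2]

theorem IsOutwardUnitNormal.outwardNormal_eq {Ω : Set Space} {x n : Space}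
    (h : IsOutwardUnitNormal Ω x n) : outwardNormal Ω x = n := by
  have hex : ∃ n, IsOutwardUnitNormal Ω x n := ⟨n, h⟩
  rw [outwardNormal, dif_pos hex]
  exact hex.choose_spec.unique h

theorem norm_outwardNormal_le_one (Ω : Set Space) (x : Space) : ‖outwardNormal Ω x‖ ≤ 1 := by
  unfold outwardNormal
  split_ifs with h
  · obtain ⟨U, ρ, -, -, -, -, hne, -, hn⟩ := h.choose_spec
    rw [hn, norm_smul, norm_inv, norm_norm, inv_mul_cancel₀ (by simpa)]
  · simp

theorem eq_zero_of_mem_frontier {Ω U : Set Space} {ρ : Space → ℝ} (hΩo : IsOpen Ω) (hU : IsOpen U)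
    (hρ : ContinuousOn ρ U) (hΩ : Ω ∩ U = {y ∈ U | ρ y < 0}) {x : Space} (hx : x ∈ frontier Ω)
    (hxU : x ∈ U) : ρ x = 0 := by
  rw [hΩo.frontier_eq] at hx
  refine le_antisymm (not_lt.1 fun h => ?_) (not_lt.1 fun h => hx.2 ?_)
  · have h1 : ∀ᶠ y in 𝓝 x, y ∈ U ∧ 0 < ρ y :=
      inter_mem (hU.mem_nhds hxU) ((hρ.continuousAt (hU.mem_nhds hxU)).eventually_const_lt h)
    obtain ⟨y, hy, hyΩ⟩ := (mem_closure_iff_nhds.1 hx.1 _ h1)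
    have : y ∈ Ω ∩ U := ⟨hyΩ, hy.1⟩
    rw [hΩ] at this
    linarith [this.2, hy.2]
  · have : x ∈ Ω ∩ U := by rw [hΩ]; exact ⟨hxU, h⟩
    exact this.1

/-- The points of the boundary at which there is an outward unit normal. -/
def regularPoints (Ω : Set Space) : Set Space :=
  {x ∈ frontier Ω | ∃ n, IsOutwardUnitNormal Ω x n}

/-- Near a regular boundary point the normalised gradient of one and the same defining function is
the outward unit normal at all boundary points. -/
theorem eventually_isOutwardUnitNormal {Ω U : Set Space} {ρ : Space → ℝ} {x : Space}
    (hΩo : IsOpen Ω) (hU : IsOpen U) (hxU : x ∈ U) (hρ : ContDiffOn ℝ 1 ρ U) (hne : ∇ ρ x ≠ 0)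
    (hΩ : Ω ∩ U = {y ∈ U | ρ y < 0}) :
    ∀ᶠ y in 𝓝 x, y ∈ frontier Ω → IsOutwardUnitNormal Ω y (‖∇ ρ y‖⁻¹ • ∇ ρ y) := by
  filter_upwards [hU.mem_nhds hxU, (continuousAt_gradient hU hρ hxU).eventually_ne hne]
    with y hyU hy hyf
  exact ⟨U, ρ, hU, hyU, hρ, eq_zero_of_mem_frontier hΩo hU hρ.continuousOn hΩ hyf hyU, hy, hΩ, rfl⟩

theorem exists_isOpen_regularPoints_eq {Ω : Set Space} (hΩo : IsOpen Ω) :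
    ∃ O, IsOpen O ∧ regularPoints Ω = frontier Ω ∩ O := by
  refine ⟨interior {x | x ∈ frontier Ω → x ∈ regularPoints Ω}, isOpen_interior, ?_⟩
  ext x
  constructor
  · rintro ⟨hx, n, U, ρ, hU, hxU, hρ, h0, hne, hΩ, hn⟩
    refine ⟨hx, mem_interior_iff_mem_nhds.2 ?_⟩
    filter_upwards [eventually_isOutwardUnitNormal hΩo hU hxU hρ hne hΩ] with y hy hyf
    exact ⟨hyf, _, hy hyf⟩
  · rintro ⟨hx, hxi⟩
    exact interior_subset hxi hx

theorem continuousOn_outwardNormal {Ω : Set Space} (hΩo : IsOpen Ω) :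
    ContinuousOn (outwardNormal Ω) (regularPoints Ω) := by
  rintro x ⟨hx, n, U, ρ, hU, hxU, hρ, h0, hne, hΩ, hn⟩
  have hc : ContinuousAt (fun y => ‖∇ ρ y‖⁻¹ • ∇ ρ y) x := by
    have := continuousAt_gradient hU hρ hxU
    exact (this.norm.inv₀ (by simpa)).smul this
  have hev := eventually_isOutwardUnitNormal hΩo hU hxU hρ hne hΩ
  refine hc.continuousWithinAt.congr_of_eventuallyEq ?_ (hev.self_of_nhds hx).outwardNormal_eq
  filter_upwards [nhdsWithin_le_nhds hev, self_mem_nhdsWithin] with y hy hyR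
  exact (hy hyR.1).outwardNormal_eq

theorem isCompact_frontier {Ω : Set Space} (hΩ : Bornology.IsBounded Ω) :
    IsCompact (frontier Ω) :=
  Metric.isCompact_of_isClosed_isBounded isClosed_frontier
    (hΩ.closure.subset frontier_subset_closure)

theorem IsRegularRegion.aestronglyMeasurable_outwardNormal {Ω : Set Space}
    (hΩ : IsRegularRegion Ω) :
    AEStronglyMeasurable (outwardNormal Ω) ((μHE[2] : Measure Space).restrict (frontier Ω)) := by
  obtain ⟨O, hO, hR⟩ := exists_isOpen_regularPoints_eq hΩ.isOpen
  have hRm : MeasurableSet (regularPoints Ω) := by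
    rw [hR]; exact isClosed_frontier.measurableSet.inter hO.measurableSet
  have hae : (frontier Ω : Set Space) =ᵐ[μHE[2]] regularPoints Ω := by
    have h := (ae_restrict_iff' isClosed_frontier.measurableSet).1 hΩ.ae_normal
    filter_upwards [h] with x hx
    exact propext ⟨fun hxf => ⟨hxf, hx hxf⟩, fun h => h.1⟩
  rw [Measure.restrict_congr_set hae]
  exact (continuousOn_outwardNormal hΩ.isOpen).aestronglyMeasurable hRm

theorem IsRegularRegion.isFiniteMeasure {Ω : Set Space} (hΩ : IsRegularRegion Ω) :
    IsFiniteMeasure ((μHE[2] : Measure Space).restrict (frontier Ω)) :=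
  ⟨by rw [Measure.restrict_apply_univ]; exact hΩ.area_ne_top.lt_top⟩

theorem IsRegularRegion.integrableOn_inner_outwardNormal {Ω : Set Space} (hΩ : IsRegularRegion Ω)
    {a : Space → Space} (ha : ContinuousOn a (frontier Ω)) :
    IntegrableOn (fun x => inner ℝ (a x) (outwardNormal Ω x)) (frontier Ω) μHE[2] := by
  have := hΩ.isFiniteMeasure
  have hc := isCompact_frontier hΩ.isBounded
  obtain ⟨C, hC⟩ := hc.exists_bound_of_continuousOn ha
  refine Integrable.of_bound (C := C)
    ((ha.aestronglyMeasurable isClosed_frontier.measurableSet).inner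
      hΩ.aestronglyMeasurable_outwardNormal) ?_
  filter_upwards [ae_restrict_mem isClosed_frontier.measurableSet] with x hx
  calc ‖inner ℝ (a x) (outwardNormal Ω x)‖ ≤ ‖a x‖ * ‖outwardNormal Ω x‖ := norm_inner_le_norm _ _
    _ ≤ ‖a x‖ * 1 := by gcongr; exact norm_outwardNormal_le_one _ _
    _ ≤ C := by rw [mul_one]; exact hC x hx

/-- A parametrisation of the boundary near a regular point, as a graph in the direction `e`. The
component of the outward normal along `e` is the reciprocal of the area factor of the graph. -/
theorem exists_boundary_chart {Ω U : Set Space} {ρ : Space → ℝ} {x₀ e : Space} (hΩo : IsOpen Ω)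
    (hU : IsOpen U) (hxU : x₀ ∈ U) (hρ : ContDiffOn ℝ 1 ρ U) (h0 : ρ x₀ = 0)
    (hΩ : Ω ∩ U = {y ∈ U | ρ y < 0}) (he : ‖e‖ = 1) (hpos : 0 < inner ℝ (∇ ρ x₀) e) :
    ∃ (D : Set (plane e)) (a b : ℝ) (f : plane e → ℝ), IsOpen D ∧ planeProj e x₀ ∈ D ∧
      inner ℝ e x₀ ∈ Ioo a b ∧ ContDiffOn ℝ 1 f D ∧ ∀ w ∈ D, f w ∈ Ioo a b ∧
        0 < (fderiv ℝ (fun w : plane e => (w : Space) + f w • e) w).toLinearMap.normDet ∧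
        inner ℝ (outwardNormal Ω (w + f w • e)) e =
          (fderiv ℝ (fun w : plane e => (w : Space) + f w • e) w).toLinearMap.normDet⁻¹ ∧
        ∀ s ∈ Ioo a b, ((w : Space) + s • e ∈ Ω ↔ s < f w) ∧
          ((w : Space) + s • e ∈ frontier Ω ↔ s = f w) := by
  rw [inner_gradient_left] at hpos
  obtain ⟨D, a, b, f, hD, hxD, hxab, hf, hch⟩ := exists_graph_chart he hU hxU hρ h0 hpos
  refine ⟨D, a, b, f, hD, hxD, hxab, hf, fun w hw => ?_⟩
  obtain ⟨hfw, hs⟩ := hch w hw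
  have hΩs : ∀ s ∈ Ioo a b, ((w : Space) + s • e ∈ Ω ↔ s < f w) := fun s hsab => by
    obtain ⟨h1, -, h2, -⟩ := hs s hsab
    rw [← h2]
    have h3 : (w : Space) + s • e ∈ Ω ∩ U ↔ (w : Space) + s • e ∈ {y ∈ U | ρ y < 0} := by rw [hΩ]
    exact ⟨fun h => (h3.1 ⟨h, h1⟩).2, fun h => (h3.2 ⟨h1, h⟩).1⟩
  have hfr : ∀ s ∈ Ioo a b, ((w : Space) + s • e ∈ frontier Ω ↔ s = f w) := fun s hsab => by
    constructor
    · intro h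
      exact (hs s hsab).2.2.2.1
        (eq_zero_of_mem_frontier hΩo hU hρ.continuousOn hΩ h (hs s hsab).1)
    · rintro rfl
      rw [hΩo.frontier_eq]
      refine ⟨?_, fun h => lt_irrefl _ ((hΩs _ hsab).1 h)⟩
      have hc : Continuous fun s : ℝ => (w : Space) + s • e := by fun_prop
      have hcl : f w ∈ closure (Ioo a (f w)) := by
        rw [closure_Ioo hsab.1.ne]; exact right_mem_Icc.2 hsab.1.le
      refine map_mem_closure (f := fun s : ℝ => (w : Space) + s • e) hc hcl fun s hs' => ?_
      exact (hΩs s ⟨hs'.1, hs'.2.trans hsab.2⟩).2 hs'.2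
  obtain ⟨hGU, hGpos, -, hG0⟩ := hs (f w) hfw
  set x := (w : Space) + f w • e
  set N := ∇ ρ x with hN
  have hNe : 0 < inner ℝ N e := by rw [hN, inner_gradient_left]; exact hGpos
  have hN0 : N ≠ 0 := by rintro h; simp [h] at hNe
  have hnorm : IsOutwardUnitNormal Ω x (‖N‖⁻¹ • N) :=
    ⟨U, ρ, hU, hGU, hρ, hG0.2 rfl, hN0, hΩ, rfl⟩
  have hfd : HasFDerivAt f (fderiv ℝ f w) w :=
    ((hf.contDiffAt (hD.mem_nhds hw)).differentiableAt one_ne_zero).hasFDerivAt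
  have hGd : HasFDerivAt (fun w : plane e => (w : Space) + f w • e)
      ((plane e).subtypeL + (fderiv ℝ f w).smulRight e) w :=
    (plane e).subtypeL.hasFDerivAt.add (hfd.smul_const e)
  have htan : ∀ v : plane e, inner ℝ N (v : Space) + fderiv ℝ f w v * inner ℝ N e = 0 := by
    intro v
    have h1 : HasFDerivAt (fun w : plane e => ρ ((w : Space) + f w • e))
        (fderiv ℝ ρ x ∘L ((plane e).subtypeL + (fderiv ℝ f w).smulRight e)) w :=
      HasFDerivAt.comp w
        ((hρ.contDiffAt (hU.mem_nhds hGU)).differentiableAt one_ne_zero).hasFDerivAt hGd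
    have h2 : HasFDerivAt (fun w : plane e => ρ ((w : Space) + f w • e))
        (0 : plane e →L[ℝ] ℝ) w :=
      (hasFDerivAt_const (0 : ℝ) w).congr_of_eventuallyEq (by
        filter_upwards [hD.mem_nhds hw] with z hz
        exact ((hch z hz).2 (f z) (hch z hz).1).2.2.2.2 rfl)
    have h3 := congr($(h1.unique h2) v)
    simp only [ContinuousLinearMap.comp_apply, add_apply,
      ContinuousLinearMap.smulRight_apply, Submodule.subtypeL_apply, map_add, map_smul,
      smul_eq_mul, zero_apply] at h3
    rw [hN, inner_gradient_left, inner_gradient_left]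
    exact h3
  have hdet := normDet_graph he hNe htan
  rw [hGd.fderiv, hdet]
  refine ⟨hfw, div_pos (norm_pos_iff.2 hN0) hNe, ?_, fun s hsab => ⟨hΩs s hsab, hfr s hsab⟩⟩
  rw [hnorm.outwardNormal_eq, inner_smul_left, inv_div]
  simp [div_eq_inv_mul]

/-! ### The divergence theorem near a regular boundary point -/

/-- The Gauss–Green formula `∫_Ω ∂φ/∂e = ∫_{∂Ω} φ (n · e)`. -/
def GaussGreen (Ω : Set Space) (e : Space) (φ : Space → ℝ) : Prop :=
  ∫ x in Ω, fderiv ℝ φ x e =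
    ∫ x in frontier Ω, φ x * inner ℝ (outwardNormal Ω x) e ∂μHE[2]

theorem fderiv_eq_zero_of_notMem_tsupport {φ : Space → ℝ} {x : Space} (hx : x ∉ tsupport φ) :
    fderiv ℝ φ x = 0 :=
  image_eq_zero_of_notMem_tsupport fun h => hx (tsupport_fderiv_subset ℝ h)

theorem isOpen_chart (e : Space) {D : Set (plane e)} (hD : IsOpen D) (a b : ℝ) :
    IsOpen {x : Space | planeProj e x ∈ D ∧ inner ℝ e x ∈ Ioo a b} :=
  (hD.preimage (planeProj e).continuous).inter
    (isOpen_Ioo.preimage (f := fun x : Space => inner ℝ e x) (by fun_prop))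

section Chart

variable {Ω : Set Space} {e : Space} {D : Set (plane e)} {a b : ℝ} {f : plane e → ℝ}

/-- The volume integral of a directional derivative over a set lying below a graph, by Fubini's
theorem and the fundamental theorem of calculus on the lines parallel to `e`. -/
theorem setIntegral_fderiv_eq_integral_graph (hΩo : IsOpen Ω) (he : ‖e‖ = 1) (hD : IsOpen D)
    (hΩ : ∀ w ∈ D, f w ∈ Ioo a b ∧ ∀ s ∈ Ioo a b, ((w : Space) + s • e ∈ Ω ↔ s < f w))
    {φ : Space → ℝ} (hφ : ContDiff ℝ 1 φ) (hφc : HasCompactSupport φ)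
    (hsupp : ∀ w : plane e, ∀ s : ℝ, (w : Space) + s • e ∈ tsupport φ → w ∈ D ∧ s ∈ Ioo a b) :
    ∫ x in Ω, fderiv ℝ φ x e = ∫ w in D, φ ((w : Space) + f w • e) := by
  set g : Space → ℝ := fun x => fderiv ℝ φ x e with hg
  have hgc : Continuous g := (hφ.continuous_fderiv one_ne_zero).clm_apply continuous_const
  have hgi : Integrable g := hgc.integrable_of_hasCompactSupport (hφc.fderiv_apply (𝕜 := ℝ) e)
  have hg0 : ∀ x ∉ tsupport φ, g x = 0 := fun x hx => by
    simp [hg, fderiv_eq_zero_of_notMem_tsupport hx]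
  have hmp := measurePreserving_coordEquiv he
  have hT : ∀ p : plane e × ℝ, coordEquiv he p = (p.1 : Space) + p.2 • e := fun p => rfl
  have hint : Integrable (fun p : plane e × ℝ => Ω.indicator g (coordEquiv he p)) :=
    (hmp.integrable_comp_emb (coordEquiv he).measurableEmbedding).2
      (hgi.indicator hΩo.measurableSet)
  rw [← integral_indicator hΩo.measurableSet,
    ← hmp.integral_comp (coordEquiv he).measurableEmbedding, Measure.volume_eq_prod,
    integral_prod _ hint, ← integral_indicator hD.measurableSet]
  refine integral_congr_ae (Eventually.of_forall fun w => ?_)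
  by_cases hw : w ∈ D
  · obtain ⟨hfw, hs⟩ := hΩ w hw
    have h1 : (fun s : ℝ => Ω.indicator g (coordEquiv he (w, s))) =
        (Ioo a (f w)).indicator fun s => g ((w : Space) + s • e) := by
      ext s
      rw [hT]
      by_cases hsab : s ∈ Ioo a b
      · have h2 : (w : Space) + s • e ∈ Ω ↔ s ∈ Ioo a (f w) := by
          rw [hs s hsab]; exact ⟨fun h => ⟨hsab.1, h⟩, fun h => h.2⟩
        simp only [indicator, h2]
      · have h2 : g ((w : Space) + s • e) = 0 := hg0 _ fun h => hsab (hsupp w s h).2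
        simp [indicator, h2]
    have h3 : ∀ s, HasDerivAt (fun s : ℝ => φ ((w : Space) + s • e))
        (g ((w : Space) + s • e)) s := fun s => by
      have h4 : HasDerivAt (fun s : ℝ => (w : Space) + s • e) e s := by
        simpa using ((hasDerivAt_id s).smul_const e).const_add (w : Space)
      exact ((hφ.differentiable one_ne_zero _).hasFDerivAt).comp_hasDerivAt s h4
    have h5 : φ ((w : Space) + a • e) = 0 :=
      image_eq_zero_of_notMem_tsupport fun h => lt_irrefl _ (hsupp w a h).2.1
    have h6 : Continuous fun s : ℝ => g ((w : Space) + s • e) := hgc.comp (by fun_prop)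
    simp only [h1, indicator_of_mem hw]
    rw [integral_indicator measurableSet_Ioo, ← integral_Ioc_eq_integral_Ioo,
      ← intervalIntegral.integral_of_le hfw.1.le,
      intervalIntegral.integral_eq_sub_of_hasDerivAt (fun s _ => h3 s)
        (h6.intervalIntegrable _ _), h5, sub_zero]
  · rw [indicator_of_notMem hw]
    refine integral_eq_zero_of_ae (Eventually.of_forall fun s => ?_)
    have h2 : g ((w : Space) + s • e) = 0 := hg0 _ fun h => hw (hsupp w s h).1
    simp [hT, indicator, h2]

theorem map_planeProj_restrict_graph (he : ‖e‖ = 1) (hD : IsOpen D) (hf : ContDiffOn ℝ 1 f D) :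
    Measure.map (planeProj e)
        ((μHE[2] : Measure Space).restrict ((fun w : plane e => (w : Space) + f w • e) '' D)) =
      (volume.restrict D).withDensity fun w => .ofReal
        (fderiv ℝ (fun w : plane e => (w : Space) + f w • e) w).toLinearMap.normDet := by
  have hG : ContDiffOn ℝ 1 (fun w : plane e => (w : Space) + f w • e) D :=
    (plane e).subtypeL.contDiff.contDiffOn.add (hf.smul contDiffOn_const)
  have h := map_euclideanHausdorffMeasure_restrict_image hD hG (planeProj e)
    (Submodule.norm_orthogonalProjectionOnto_apply_le _)
    fun w _ => planeProj_coe_add_smul e w (f w)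
  rwa [finrank_plane he] at h

/-- The surface integral over a boundary that is a graph, in orthogonal coordinates: the area factor
of the graph cancels against the component of the normal. -/
theorem integral_graph_eq_setIntegral_frontier (he : ‖e‖ = 1) (hD : IsOpen D)
    (hf : ContDiffOn ℝ 1 f D)
    (hΩ : ∀ w ∈ D, f w ∈ Ioo a b ∧
        0 < (fderiv ℝ (fun w : plane e => (w : Space) + f w • e) w).toLinearMap.normDet ∧
        inner ℝ (outwardNormal Ω (w + f w • e)) e =
          (fderiv ℝ (fun w : plane e => (w : Space) + f w • e) w).toLinearMap.normDet⁻¹ ∧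
        ∀ s ∈ Ioo a b, ((w : Space) + s • e ∈ frontier Ω ↔ s = f w))
    {φ : Space → ℝ} (hφ : Continuous φ)
    (hsupp : ∀ w : plane e, ∀ s : ℝ, (w : Space) + s • e ∈ tsupport φ → w ∈ D ∧ s ∈ Ioo a b) :
    ∫ w in D, φ ((w : Space) + f w • e) =
      ∫ x in frontier Ω, φ x * inner ℝ (outwardNormal Ω x) e ∂μHE[2] := by
  set G : plane e → Space := fun w => (w : Space) + f w • e with hGdef
  set J : plane e → ℝ := fun w => (fderiv ℝ G w).toLinearMap.normDet
  have hG : ContDiffOn ℝ 1 G D :=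
    (plane e).subtypeL.contDiff.contDiffOn.add (hf.smul contDiffOn_const)
  have hJc : ContinuousOn J D :=
    continuous_normDet.comp_continuousOn (hG.continuousOn_fderiv_of_isOpen hD le_rfl)
  have hPG : ∀ w, planeProj e (G w) = w := fun w => planeProj_coe_add_smul e w (f w)
  have hmap := map_planeProj_restrict_graph he hD hf
  have hGf : ∀ w ∈ D, G w ∈ frontier Ω := fun w hw => ((hΩ w hw).2.2.2 _ (hΩ w hw).1).2 rfl
  -- The graph is a measurable set: it is the part of the boundary inside the chart.
  have himg : G '' D = frontier Ω ∩ {x | planeProj e x ∈ D ∧ inner ℝ e x ∈ Ioo a b} := by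
    ext x
    constructor
    · rintro ⟨w, hw, rfl⟩
      exact ⟨hGf w hw, by simpa only [hPG] using hw,
        by simpa only [hGdef, inner_coe_add_smul he] using (hΩ w hw).1⟩
    · rintro ⟨hx, hxD, hxab⟩
      refine ⟨planeProj e x, hxD, ?_⟩
      have h1 := planeProj_add_inner_smul he x
      have h2 := ((hΩ _ hxD).2.2.2 _ hxab).1 (by rwa [h1])
      rw [hGdef]
      simp only
      rw [← h2, h1]
  have hGm : MeasurableSet (G '' D) := by
    rw [himg]
    exact isClosed_frontier.measurableSet.inter (isOpen_chart e hD a b).measurableSet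
  have h1 : ∫ x in frontier Ω, φ x * inner ℝ (outwardNormal Ω x) e ∂μHE[2] =
      ∫ x in G '' D, φ x * inner ℝ (outwardNormal Ω x) e ∂μHE[2] := by
    refine setIntegral_eq_of_subset_of_forall_sdiff_eq_zero isClosed_frontier.measurableSet
      (by rw [himg]; exact inter_subset_left) fun x hx => ?_
    have : x ∉ tsupport φ := fun h => hx.2 (by
      rw [himg]
      exact ⟨hx.1, hsupp _ _ (by rwa [planeProj_add_inner_smul he])⟩)
    rw [image_eq_zero_of_notMem_tsupport this, zero_mul]
  have h2 : ∫ x in G '' D, φ x * inner ℝ (outwardNormal Ω x) e ∂μHE[2] =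
      ∫ x in G '' D, φ (G (planeProj e x)) * (J (planeProj e x))⁻¹ ∂μHE[2] := by
    refine setIntegral_congr_fun hGm ?_
    rintro _ ⟨w, hw, rfl⟩
    simp only [hPG]
    rw [(hΩ w hw).2.2.1]
  have hcont : ContinuousOn (fun w => φ (G w) * (J w)⁻¹) D :=
    (hφ.comp_continuousOn hG.continuousOn).mul (hJc.inv₀ fun w hw => (hΩ w hw).2.1.ne')
  have h3 := integral_map (μ := (μHE[2] : Measure Space).restrict (G '' D))
    (planeProj e).continuous.measurable.aemeasurable (f := fun w => φ (G w) * (J w)⁻¹) (by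
      rw [hmap]
      exact (hcont.aestronglyMeasurable hD.measurableSet).mono_ac
        (withDensity_absolutelyContinuous _ _))
  rw [h1, h2, ← h3, hmap, integral_withDensity_eq_integral_toReal_smul₀
    ((hJc.aemeasurable hD.measurableSet).ennreal_ofReal)
    (Eventually.of_forall fun _ => ENNReal.ofReal_lt_top)]
  refine setIntegral_congr_fun hD.measurableSet fun w hw => ?_
  have hpos := (hΩ w hw).2.1
  simp only [smul_eq_mul]
  rw [ENNReal.toReal_ofReal hpos.le]
  change _ = J w * (φ (G w) * (J w)⁻¹)
  have : J w ≠ 0 := hpos.ne'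
  field_simp
  rfl

end Chart

section Local

variable {Ω U : Set Space} {ρ : Space → ℝ} {x₀ e : Space}

/-- The Gauss–Green formula near a regular boundary point, in a direction pointing out of the
region. -/
theorem exists_nhds_gaussGreen_of_inner_pos (hΩo : IsOpen Ω)
    (hU : IsOpen U) (hxU : x₀ ∈ U) (hρ : ContDiffOn ℝ 1 ρ U) (h0 : ρ x₀ = 0)
    (hΩ : Ω ∩ U = {y ∈ U | ρ y < 0}) (he : ‖e‖ = 1) (hpos : 0 < inner ℝ (∇ ρ x₀) e) :
    ∃ V, IsOpen V ∧ x₀ ∈ V ∧ ∀ φ : Space → ℝ, ContDiff ℝ 1 φ → HasCompactSupport φ →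
      tsupport φ ⊆ V → GaussGreen Ω e φ := by
  obtain ⟨D, a, b, f, hD, hxD, hxab, hf, hch⟩ :=
    exists_boundary_chart hΩo hU hxU hρ h0 hΩ he hpos
  refine ⟨_, isOpen_chart e hD a b, ⟨hxD, hxab⟩, fun φ hφ hφc hφV => ?_⟩
  have hsupp : ∀ w : plane e, ∀ s : ℝ, (w : Space) + s • e ∈ tsupport φ →
      w ∈ D ∧ s ∈ Ioo a b := fun w s h => by
    have := hφV h
    rwa [mem_ofPred_eq, planeProj_coe_add_smul, inner_coe_add_smul he] at this
  rw [GaussGreen, setIntegral_fderiv_eq_integral_graph hΩo he hD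
    (fun w hw => ⟨(hch w hw).1, fun s hs => ((hch w hw).2.2.2 s hs).1⟩) hφ hφc hsupp]
  exact integral_graph_eq_setIntegral_frontier he hD hf (fun w hw => ⟨(hch w hw).1,
    (hch w hw).2.1, (hch w hw).2.2.1, fun s hs => ((hch w hw).2.2.2 s hs).2⟩) hφ.continuous hsupp

/-- The boundary has locally finite area at its regular points. -/
theorem IsOutwardUnitNormal.exists_nhds_area_lt_top {n : Space} (hΩo : IsOpen Ω)
    (hn : IsOutwardUnitNormal Ω x₀ n) :
    ∃ V, IsOpen V ∧ x₀ ∈ V ∧ μHE[2] (frontier Ω ∩ V) < ⊤ := by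
  obtain ⟨U, ρ, hU, hxU, hρ, h0, hne, hΩ, -⟩ := hn
  set e := ‖∇ ρ x₀‖⁻¹ • ∇ ρ x₀ with hedef
  have he : ‖e‖ = 1 := by
    rw [hedef, norm_smul, norm_inv, norm_norm, inv_mul_cancel₀ (by simpa)]
  have hpos : 0 < inner ℝ (∇ ρ x₀) e := by
    rw [hedef, inner_smul_right, real_inner_self_eq_norm_sq]
    have := norm_pos_iff.2 hne
    positivity
  obtain ⟨D, a, b, f, hD, hxD, hxab, hf, hch⟩ :=
    exists_boundary_chart hΩo hU hxU hρ h0 hΩ he hpos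
  set G : plane e → Space := fun w => (w : Space) + f w • e with hGdef
  set J : plane e → ℝ := fun w => (fderiv ℝ G w).toLinearMap.normDet
  have hG : ContDiffOn ℝ 1 G D :=
    (plane e).subtypeL.contDiff.contDiffOn.add (hf.smul contDiffOn_const)
  have hJc : ContinuousOn J D :=
    continuous_normDet.comp_continuousOn (hG.continuousOn_fderiv_of_isOpen hD le_rfl)
  obtain ⟨K, hK, hKD, hxK⟩ : ∃ K, IsCompact K ∧ K ⊆ D ∧ K ∈ 𝓝 (planeProj e x₀) := by
    obtain ⟨K, hKn, hKD, hK⟩ := local_compact_nhds (hD.mem_nhds hxD)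
    exact ⟨K, hK, hKD, hKn⟩
  obtain ⟨N, hNK, hN, hxN⟩ := mem_nhds_iff.1 hxK
  obtain ⟨C, hC⟩ := hK.exists_bound_of_continuousOn (hJc.mono hKD)
  refine ⟨_, isOpen_chart e hN a b, ⟨hxN, hxab⟩, ?_⟩
  have hsub : frontier Ω ∩ {x | planeProj e x ∈ N ∧ inner ℝ e x ∈ Ioo a b} ⊆
      planeProj e ⁻¹' N ∩ G '' D := by
    rintro x ⟨hx, hxN, hxab⟩
    have hxD := hKD (hNK hxN)
    refine ⟨hxN, planeProj e x, hxD, ?_⟩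
    have h1 := planeProj_add_inner_smul he x
    have h2 := (((hch _ hxD).2.2.2 _ hxab).2).1 (by rwa [h1])
    rw [hGdef]
    simp only
    rw [← h2, h1]
  calc μHE[2] (frontier Ω ∩ {x | planeProj e x ∈ N ∧ inner ℝ e x ∈ Ioo a b})
      ≤ μHE[2] (planeProj e ⁻¹' N ∩ G '' D) := measure_mono hsub
    _ = Measure.map (planeProj e) ((μHE[2] : Measure Space).restrict (G '' D)) N := by
        rw [Measure.map_apply (planeProj e).continuous.measurable hN.measurableSet,
          Measure.restrict_apply ((planeProj e).continuous.measurable hN.measurableSet)]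
    _ = ∫⁻ w in N, .ofReal (J w) := by
        rw [map_planeProj_restrict_graph he hD hf, withDensity_apply _ hN.measurableSet,
          Measure.restrict_restrict hN.measurableSet, inter_eq_left.2 (hNK.trans hKD)]
    _ ≤ ∫⁻ w in N, .ofReal C := by
        refine setLIntegral_mono' hN.measurableSet fun w hw => ENNReal.ofReal_le_ofReal ?_
        exact (le_abs_self _).trans (hC w (hNK hw))
    _ < ⊤ := by
        rw [setLIntegral_const]
        exact ENNReal.mul_lt_top ENNReal.ofReal_lt_top
          ((measure_mono hNK).trans_lt hK.measure_lt_top)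

end Local

section Linear

variable {Ω : Set Space} {φ : Space → ℝ}

theorem GaussGreen.smul {e : Space} (h : GaussGreen Ω e φ) (c : ℝ) : GaussGreen Ω (c • e) φ := by
  unfold GaussGreen at *
  simp only [map_smul, smul_eq_mul, inner_smul_right, mul_left_comm _ c]
  rw [integral_const_mul, integral_const_mul, h]

theorem IsRegularRegion.integrableOn_mul_inner (hΩ : IsRegularRegion Ω)
    (hφ : ContinuousOn φ (frontier Ω)) (e : Space) :
    IntegrableOn (fun x => φ x * inner ℝ (outwardNormal Ω x) e) (frontier Ω) μHE[2] := by
  have h := hΩ.integrableOn_inner_outwardNormal (a := fun x => φ x • e)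
    (hφ.smul continuousOn_const)
  refine h.congr_fun (fun x _ => ?_) isClosed_frontier.measurableSet
  simp only [inner_smul_left, conj_trivial, real_inner_comm]

theorem integrable_fderiv_apply (hφ : ContDiff ℝ 1 φ) (hφc : HasCompactSupport φ) (e : Space) :
    Integrable fun x => fderiv ℝ φ x e :=
  ((hφ.continuous_fderiv one_ne_zero).clm_apply continuous_const).integrable_of_hasCompactSupport
    (hφc.fderiv_apply (𝕜 := ℝ) e)

theorem GaussGreen.add_direction {e e' : Space} (hΩ : IsRegularRegion Ω) (hφ : ContDiff ℝ 1 φ)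
    (hφc : HasCompactSupport φ) (h : GaussGreen Ω e φ) (h' : GaussGreen Ω e' φ) :
    GaussGreen Ω (e + e') φ := by
  unfold GaussGreen at *
  simp only [map_add, inner_add_right, mul_add]
  rw [integral_add (integrable_fderiv_apply hφ hφc e).integrableOn
    (integrable_fderiv_apply hφ hφc e').integrableOn,
    integral_add (hΩ.integrableOn_mul_inner hφ.continuous.continuousOn e)
      (hΩ.integrableOn_mul_inner hφ.continuous.continuousOn e'), h, h']

theorem GaussGreen.sum {ι : Type*} {s : Finset ι} {e : Space} {φ : ι → Space → ℝ}
    (hΩ : IsRegularRegion Ω) (hφ : ∀ i ∈ s, ContDiff ℝ 1 (φ i))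
    (hφc : ∀ i ∈ s, HasCompactSupport (φ i))
    (h : ∀ i ∈ s, GaussGreen Ω e (φ i)) : GaussGreen Ω e (fun x => ∑ i ∈ s, φ i x) := by
  have h1 : ∀ x, fderiv ℝ (fun x => ∑ i ∈ s, φ i x) x e = ∑ i ∈ s, fderiv ℝ (φ i) x e := by
    intro x
    rw [fderiv_fun_sum fun i hi => (hφ i hi).differentiable one_ne_zero x]
    simp
  unfold GaussGreen
  simp only [h1, Finset.sum_mul]
  rw [integral_finsetSum _ fun i hi =>
      (integrable_fderiv_apply (hφ i hi) (hφc i hi) e).integrableOn,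
    integral_finsetSum _ fun i hi => hΩ.integrableOn_mul_inner (hφ i hi).continuous.continuousOn e]
  exact Finset.sum_congr rfl fun i hi => h i hi

/-- The Gauss–Green formula near a regular boundary point, in all directions: the directions in
which it holds form a linear space, and this space contains all directions transversal to the
boundary. -/
theorem IsRegularRegion.exists_nhds_gaussGreen (hΩ : IsRegularRegion Ω) {x₀ n : Space}
    (hn : IsOutwardUnitNormal Ω x₀ n) (e : Space) :
    ∃ V, IsOpen V ∧ x₀ ∈ V ∧ ∀ φ : Space → ℝ, ContDiff ℝ 1 φ → HasCompactSupport φ →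
      tsupport φ ⊆ V → GaussGreen Ω e φ := by
  obtain ⟨U, ρ, hU, hxU, hρ, h0, hne, hΩU, -⟩ := hn
  have hscal : ∀ (e : Space) (c : ℝ), (∃ V, IsOpen V ∧ x₀ ∈ V ∧ ∀ φ : Space → ℝ, ContDiff ℝ 1 φ →
      HasCompactSupport φ → tsupport φ ⊆ V → GaussGreen Ω e φ) →
      ∃ V, IsOpen V ∧ x₀ ∈ V ∧ ∀ φ : Space → ℝ, ContDiff ℝ 1 φ → HasCompactSupport φ →
        tsupport φ ⊆ V → GaussGreen Ω (c • e) φ := by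
    rintro e c ⟨V, hV, hxV, h⟩
    exact ⟨V, hV, hxV, fun φ h1 h2 h3 => (h φ h1 h2 h3).smul c⟩
  have htrans : ∀ e : Space, inner ℝ (∇ ρ x₀) e ≠ 0 → ∃ V, IsOpen V ∧ x₀ ∈ V ∧ ∀ φ : Space → ℝ,
      ContDiff ℝ 1 φ → HasCompactSupport φ → tsupport φ ⊆ V → GaussGreen Ω e φ := by
    have hposi : ∀ e : Space, 0 < inner ℝ (∇ ρ x₀) e → ∃ V, IsOpen V ∧ x₀ ∈ V ∧ ∀ φ : Space → ℝ,
        ContDiff ℝ 1 φ → HasCompactSupport φ → tsupport φ ⊆ V → GaussGreen Ω e φ := by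
      intro e hpos
      have he0 : e ≠ 0 := by rintro rfl; simp at hpos
      have he : ‖‖e‖⁻¹ • e‖ = 1 := by
        rw [norm_smul, norm_inv, norm_norm, inv_mul_cancel₀ (by simpa)]
      have h := hscal _ ‖e‖ (exists_nhds_gaussGreen_of_inner_pos hΩ.isOpen hU hxU hρ h0 hΩU he
        (by rw [inner_smul_right]; exact mul_pos (by simpa using he0) hpos))
      rwa [smul_smul, mul_inv_cancel₀ (by simpa), one_smul] at h
    intro e he
    rcases lt_or_gt_of_ne he with h | h
    · have h1 := hscal (-e) (-1) (hposi (-e) (by rw [inner_neg_right]; linarith))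
      rwa [neg_one_smul, neg_neg] at h1
    · exact hposi e h
  by_cases he : inner ℝ (∇ ρ x₀) e = 0
  -- A tangential direction is a difference of two transversal ones.
  · have hNN : inner ℝ (∇ ρ x₀) (∇ ρ x₀) ≠ 0 := by simpa using hne
    obtain ⟨V₁, hV₁, hx₁, h₁⟩ := htrans (e + ∇ ρ x₀) (by rwa [inner_add_right, he, zero_add])
    obtain ⟨V₂, hV₂, hx₂, h₂⟩ := hscal _ (-1) (htrans (∇ ρ x₀) hNN)
    refine ⟨V₁ ∩ V₂, hV₁.inter hV₂, ⟨hx₁, hx₂⟩, fun φ hφ hφc hφV => ?_⟩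
    have := (h₁ φ hφ hφc (hφV.trans inter_subset_left)).add_direction hΩ hφ hφc
      (h₂ φ hφ hφc (hφV.trans inter_subset_right))
    simpa using this
  · exact htrans e he

end Linear

/-! ### Cutting off compact sets of zero area -/

theorem hausdorffMeasure_two_eq_zero {s : Set Space} (h : μHE[2] s = 0) : μH[2] s = 0 := by
  rw [Measure.euclideanHausdorffMeasure_def, Measure.smul_apply, ENNReal.smul_def, smul_eq_mul,
    mul_eq_zero] at h
  rcases h with h | h
  · exact absurd (by exact_mod_cast h)
      (Measure.addHaarScalarFactor_volume_hausdorffMeasure_ne_zero 2)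
  · exact_mod_cast h

/-- A compact set of zero area is covered by finitely many small balls, centred on it, the squares
of whose radii have a small sum. -/
theorem exists_finite_cover_sum_sq_le {K : Set Space} (hK : IsCompact K) (h0 : μH[2] K = 0)
    {ε : ℝ} (hε : 0 < ε) :
    ∃ (I : Finset ℕ) (c : ℕ → Space) (r : ℕ → ℝ), (∀ i ∈ I, c i ∈ K ∧ 0 < r i ∧ r i ≤ ε) ∧
      K ⊆ (⋃ i ∈ I, Metric.ball (c i) (r i)) ∧ ∑ i ∈ I, r i ^ 2 ≤ ε := by
  obtain ⟨s, hs, hsε, hs2⟩ : ∃ s : ℝ, 0 < s ∧ s ≤ ε / 2 ∧ s ^ 2 ≤ ε / 8 := by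
    refine ⟨min (ε / 2) (√(ε / 8)), by positivity, min_le_left _ _, ?_⟩
    calc min (ε / 2) (√(ε / 8)) ^ 2 ≤ √(ε / 8) ^ 2 := by gcongr; exact min_le_right _ _
      _ = ε / 8 := Real.sq_sqrt (by positivity)
  rw [Measure.hausdorffMeasure_apply] at h0
  have h1 := (iSup_eq_bot.1 ((iSup_eq_bot.1 h0) (.ofReal (ε / 2))))
    (ENNReal.ofReal_pos.2 (by positivity))
  have h2 : (⊥ : ℝ≥0∞) < .ofReal (ε / 4) := ENNReal.ofReal_pos.2 (by positivity)
  rw [← h1] at h2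
  simp only [iInf_lt_iff] at h2
  obtain ⟨t, hcov, hdiam, hsum⟩ := h2
  set d : ℕ → ℝ := fun n => (Metric.ediam (t n)).toReal with hd
  have hfin : ∀ n, Metric.ediam (t n) ≠ ⊤ := fun n => ne_top_of_le_ne_top ofReal_ne_top (hdiam n)
  have hdε : ∀ n, d n ≤ ε / 2 := fun n => ENNReal.toReal_le_of_le_ofReal (by positivity) (hdiam n)
  have hd0 : ∀ n, 0 ≤ d n := fun n => ENNReal.toReal_nonneg
  set r : ℕ → ℝ := fun n => d n + s * (1 / 2) ^ n with hr
  have hpw : ∀ n : ℕ, (0 : ℝ) < (1 / 2) ^ n := fun n => by positivity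
  have hr0 : ∀ n, d n < r n := fun n => by
    have := mul_pos hs (hpw n)
    simp only [hr]
    linarith
  have hex : ∀ n, ∃ c, (t n ∩ K).Nonempty → c ∈ t n ∩ K := fun n => by
    by_cases h : (t n ∩ K).Nonempty
    · obtain ⟨c, hc⟩ := h
      exact ⟨c, fun _ => hc⟩
    · exact ⟨0, fun h' => absurd h' h⟩
  choose c hc using hex
  have hcov' : K ⊆ ⋃ n, ⋃ _ : (t n ∩ K).Nonempty, Metric.ball (c n) (r n) := fun x hx => by
    obtain ⟨n, hn⟩ := mem_iUnion.1 (hcov hx)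
    have hne : (t n ∩ K).Nonempty := ⟨x, hn, hx⟩
    refine mem_iUnion₂.2 ⟨n, hne, ?_⟩
    have h3 : edist x (c n) ≤ Metric.ediam (t n) := Metric.edist_le_ediam_of_mem hn (hc n hne).1
    have h4 : dist x (c n) ≤ d n := by
      rw [dist_edist]
      exact ENNReal.toReal_mono (hfin n) h3
    exact h4.trans_lt (hr0 n)
  obtain ⟨I, hI⟩ := hK.elim_finite_subcover _
    (fun n => isOpen_iUnion fun _ => Metric.isOpen_ball) hcov'
  classical
  refine ⟨I.filter fun n => (t n ∩ K).Nonempty, c, r, fun i hi => ?_, fun x hx => ?_, ?_⟩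
  · have hi := (Finset.mem_filter.1 hi).2
    refine ⟨(hc i hi).2, (hd0 i).trans_lt (hr0 i), ?_⟩
    have h5 : s * (1 / 2) ^ i ≤ s * 1 := by
      gcongr; exact pow_le_one₀ (by norm_num) (by norm_num)
    simp only [hr]
    linarith [hdε i]
  · obtain ⟨i, hiI, hi⟩ := mem_iUnion₂.1 (hI hx)
    obtain ⟨hne, hi⟩ := mem_iUnion.1 hi
    exact mem_iUnion₂.2 ⟨i, Finset.mem_filter.2 ⟨hiI, hne⟩, hi⟩
  · set J := I.filter fun n => (t n ∩ K).Nonempty with hJ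
    have h6 : ∑ i ∈ J, d i ^ 2 ≤ ε / 4 := by
      have h7 : ∑ i ∈ J, ENNReal.ofReal (d i ^ 2) ≤ .ofReal (ε / 4) := by
        refine le_trans (le_trans (Finset.sum_le_sum fun i hi => ?_)
          (ENNReal.sum_le_tsum J)) hsum.le
        have hne : (t i).Nonempty := (Finset.mem_filter.1 hi).2.mono inter_subset_left
        rw [iSup_pos hne, ENNReal.ofReal_pow (hd0 i), hd, ENNReal.ofReal_toReal (hfin i)]
        norm_cast
      rw [← ENNReal.ofReal_sum_of_nonneg fun i _ => sq_nonneg _] at h7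
      exact (ENNReal.ofReal_le_ofReal_iff (by positivity)).1 h7
    have h8 : ∑ i ∈ J, ((1 / 4 : ℝ)) ^ i ≤ 4 / 3 := by
      have := (summable_geometric_of_lt_one (r := (1 / 4 : ℝ)) (by norm_num)
        (by norm_num)).sum_le_tsum J (fun i _ => by positivity)
      rw [tsum_geometric_of_lt_one (by norm_num) (by norm_num)] at this
      norm_num at this ⊢
      exact this
    calc ∑ i ∈ J, r i ^ 2 ≤ ∑ i ∈ J, (2 * d i ^ 2 + 2 * s ^ 2 * (1 / 4) ^ i) := by
          refine Finset.sum_le_sum fun i _ => ?_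
          have h9 : ((1 / 4 : ℝ)) ^ i = ((1 / 2) ^ i) ^ 2 := by
            rw [← pow_mul, mul_comm, pow_mul]; norm_num
          rw [h9]
          simp only [hr]
          nlinarith [sq_nonneg (d i - s * (1 / 2) ^ i)]
      _ = 2 * ∑ i ∈ J, d i ^ 2 + 2 * s ^ 2 * ∑ i ∈ J, (1 / 4) ^ i := by
          rw [Finset.sum_add_distrib, Finset.mul_sum, Finset.mul_sum]
      _ ≤ 2 * (ε / 4) + 2 * s ^ 2 * (4 / 3) := by gcongr
      _ ≤ ε := by nlinarith

/-- Cutoff functions of balls, with gradients inversely proportional to the radius. -/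
theorem exists_ball_cutoff : ∃ C : ℝ, 0 ≤ C ∧ ∀ (c : Space) (r : ℝ), 0 < r →
    ∃ η : Space → ℝ, ContDiff ℝ 1 η ∧ (∀ x, 0 ≤ η x ∧ η x ≤ 1) ∧
      (∀ x ∈ Metric.ball c r, η x = 0) ∧ (∀ x, 2 * r ≤ dist x c → η x = 1) ∧
      ∀ x, ‖fderiv ℝ η x‖ ≤ (Metric.closedBall c (2 * r)).indicator (fun _ => C / r) x := by
  let β : ContDiffBump (0 : Space) := ⟨1, 2, one_pos, one_lt_two⟩
  have hβ : ContDiff ℝ 1 β := β.contDiff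
  obtain ⟨C, hC⟩ := (hβ.continuous_fderiv one_ne_zero).bounded_above_of_compact_support
    (β.hasCompactSupport.fderiv (𝕜 := ℝ))
  have hC0 : 0 ≤ C := (norm_nonneg _).trans (hC 0)
  refine ⟨C, hC0, fun c r hr => ⟨fun x => 1 - β (r⁻¹ • (x - c)), ?_, fun x => ?_, fun x hx => ?_,
    fun x hx => ?_, fun x => ?_⟩⟩
  · exact contDiff_const.sub (hβ.comp (by fun_prop))
  · have h1 := β.nonneg (x := r⁻¹ • (x - c))
    have h2 := β.le_one (x := r⁻¹ • (x - c))
    constructor <;> linarith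
  · have : β (r⁻¹ • (x - c)) = 1 := by
      refine β.one_of_mem_closedBall ?_
      rw [mem_closedBall_zero_iff, norm_smul, norm_inv, Real.norm_of_nonneg hr.le,
        inv_mul_le_iff₀ hr, ← dist_eq_norm]
      simpa [β] using (Metric.mem_ball.1 hx).le
    simp [this]
  · have : β (r⁻¹ • (x - c)) = 0 := by
      refine β.zero_of_le_dist ?_
      rw [dist_zero_right, norm_smul, norm_inv, Real.norm_of_nonneg hr.le, le_inv_mul_iff₀ hr,
        ← dist_eq_norm, mul_comm]
      exact hx
    simp [this]
  · have h1 : HasFDerivAt (fun x : Space => r⁻¹ • (x - c))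
        (r⁻¹ • ContinuousLinearMap.id ℝ Space) x :=
      ((hasFDerivAt_id x).sub_const c).const_smul r⁻¹
    have h2 := ((hβ.differentiable one_ne_zero (r⁻¹ • (x - c))).hasFDerivAt.comp x h1).const_sub 1
    have h3 : fderiv ℝ (fun x => 1 - β (r⁻¹ • (x - c))) x = _ := h2.fderiv
    rw [h3]
    by_cases hx : x ∈ Metric.closedBall c (2 * r)
    · rw [indicator_of_mem hx, norm_neg, ContinuousLinearMap.comp_smul, norm_smul, norm_inv,
        Real.norm_of_nonneg hr.le, ContinuousLinearMap.comp_id, div_eq_inv_mul]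
      gcongr
      exact hC _
    · rw [indicator_of_notMem hx, fderiv_eq_zero_of_notMem_tsupport]
      · simp
      · rw [β.tsupport_eq, mem_closedBall_zero_iff, norm_smul, norm_inv,
          Real.norm_of_nonneg hr.le, inv_mul_le_iff₀ hr, not_le, ← dist_eq_norm]
        rw [Metric.mem_closedBall, not_le] at hx
        change r * 2 < _
        linarith

theorem norm_fderiv_prod_le {ι : Type*} {I : Finset ι} {η : ι → Space → ℝ}
    (hη : ∀ i ∈ I, ContDiff ℝ 1 (η i)) (h01 : ∀ i ∈ I, ∀ x, 0 ≤ η i x ∧ η i x ≤ 1) (x : Space) :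
    ‖fderiv ℝ (fun x => ∏ i ∈ I, η i x) x‖ ≤ ∑ i ∈ I, ‖fderiv ℝ (η i) x‖ := by
  classical
  rw [fderiv_finsetProd fun i hi => (hη i hi).differentiable one_ne_zero x]
  refine (norm_sum_le _ _).trans (Finset.sum_le_sum fun i hi => ?_)
  rw [norm_smul]
  refine mul_le_of_le_one_left (norm_nonneg _) ?_
  rw [Real.norm_of_nonneg (Finset.prod_nonneg fun j hj => (h01 j (Finset.mem_of_mem_erase hj) x).1)]
  exact Finset.prod_le_one (fun j hj => (h01 j (Finset.mem_of_mem_erase hj) x).1)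
    fun j hj => (h01 j (Finset.mem_of_mem_erase hj) x).2

/-- A compact set of zero area can be cut off by functions whose gradients are arbitrarily small in
`L¹`: the gradient of the cutoff of a ball of radius `r` has `L¹` norm of the order of `r ^ 2`. -/
theorem exists_cutoff {K : Set Space} (hK : IsCompact K) (h0 : μH[2] K = 0) {ε : ℝ} (hε : 0 < ε) :
    ∃ η : Space → ℝ, ContDiff ℝ 1 η ∧ (∀ x, 0 ≤ η x ∧ η x ≤ 1) ∧ Disjoint (tsupport η) K ∧
      (∀ x, (∀ c ∈ K, ε ≤ dist x c) → η x = 1) ∧ Integrable (fun x => ‖fderiv ℝ η x‖) ∧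
      ∫ x, ‖fderiv ℝ η x‖ ≤ ε := by
  obtain ⟨C, hC0, hcut⟩ := exists_ball_cutoff
  set v : ℝ := volume.real (Metric.closedBall (0 : Space) 1) with hv
  have hv0 : 0 ≤ v := measureReal_nonneg
  obtain ⟨δ, hδ, hδε, hδ'⟩ : ∃ δ : ℝ, 0 < δ ∧ 2 * δ ≤ ε ∧ 8 * C * v * δ ≤ ε := by
    refine ⟨min (ε / 2) (ε / (8 * C * v + 1)), by positivity, ?_, ?_⟩
    · linarith [min_le_left (ε / 2) (ε / (8 * C * v + 1))]
    · calc 8 * C * v * min (ε / 2) (ε / (8 * C * v + 1))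
          ≤ 8 * C * v * (ε / (8 * C * v + 1)) := by gcongr; exact min_le_right _ _
        _ = ε * ((8 * C * v) / (8 * C * v + 1)) := by ring
        _ ≤ ε * 1 := by
            gcongr
            rw [div_le_one (by positivity)]
            linarith
        _ = ε := mul_one _
  obtain ⟨I, c, r, hI, hcov, hsum⟩ := exists_finite_cover_sum_sq_le hK h0 hδ
  have hex : ∀ i, ∃ η : Space → ℝ, i ∈ I → (ContDiff ℝ 1 η ∧ (∀ x, 0 ≤ η x ∧ η x ≤ 1) ∧
      (∀ x ∈ Metric.ball (c i) (r i), η x = 0) ∧ (∀ x, 2 * r i ≤ dist x (c i) → η x = 1) ∧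
      ∀ x, ‖fderiv ℝ η x‖ ≤
        (Metric.closedBall (c i) (2 * r i)).indicator (fun _ => C / r i) x) := fun i => by
    by_cases hi : i ∈ I
    · obtain ⟨η, hη⟩ := hcut (c i) (r i) (hI i hi).2.1
      exact ⟨η, fun _ => hη⟩
    · exact ⟨0, fun h => absurd h hi⟩
  choose η hη using hex
  have hcd : ContDiff ℝ 1 fun x => ∏ i ∈ I, η i x := contDiff_prod fun i hi => (hη i hi).1
  set B : Space → ℝ := fun x => ∑ i ∈ I,
    (Metric.closedBall (c i) (2 * r i)).indicator (fun _ => C / r i) x with hB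
  have hbound : ∀ x, ‖fderiv ℝ (fun x => ∏ i ∈ I, η i x) x‖ ≤ B x := fun x =>
    (norm_fderiv_prod_le (fun i hi => (hη i hi).1) (fun i hi => (hη i hi).2.1) x).trans
      (Finset.sum_le_sum fun i hi => (hη i hi).2.2.2.2 x)
  have hBi : ∀ i ∈ I, Integrable
      ((Metric.closedBall (c i) (2 * r i)).indicator fun _ : Space => C / r i) := fun i _ =>
    (integrable_indicator_iff Metric.isClosed_closedBall.measurableSet).2
      (integrableOn_const (isCompact_closedBall _ _).measure_lt_top.ne)
  have hint : Integrable (fun x => ‖fderiv ℝ (fun x => ∏ i ∈ I, η i x) x‖) := by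
    refine Integrable.mono' (integrable_finsetSum I hBi)
      (hcd.continuous_fderiv one_ne_zero).norm.aestronglyMeasurable
      (Eventually.of_forall fun x => ?_)
    rw [norm_norm]
    exact hbound x
  refine ⟨fun x => ∏ i ∈ I, η i x, hcd, fun x =>
    ⟨Finset.prod_nonneg fun i hi => ((hη i hi).2.1 x).1,
    Finset.prod_le_one (fun i hi => ((hη i hi).2.1 x).1) fun i hi => ((hη i hi).2.1 x).2⟩, ?_,
    fun x hx => Finset.prod_eq_one fun i hi => ?_, hint, ?_⟩
  · rw [Set.disjoint_left]
    intro x hx hxK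
    refine notMem_tsupport_iff_eventuallyEq.2 ?_ hx
    obtain ⟨i, hi, hxi⟩ := mem_iUnion₂.1 (hcov hxK)
    filter_upwards [Metric.isOpen_ball.mem_nhds hxi] with y hy
    exact Finset.prod_eq_zero hi ((hη i hi).2.2.1 y hy)
  · exact (hη i hi).2.2.2.1 x (by linarith [hx _ (hI i hi).1, (hI i hi).2.2])
  · calc ∫ x, ‖fderiv ℝ (fun x => ∏ i ∈ I, η i x) x‖ ≤ ∫ x, B x :=
          integral_mono hint (integrable_finsetSum I hBi) hbound
      _ = ∑ i ∈ I, 8 * C * v * r i ^ 2 := by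
          rw [hB, integral_finsetSum I hBi]
          refine Finset.sum_congr rfl fun i hi => ?_
          have hri := (hI i hi).2.1
          rw [integral_indicator Metric.isClosed_closedBall.measurableSet, setIntegral_const,
            Measure.addHaar_real_closedBall' _ _ (by positivity), ← hv, finrank_euclideanSpace_fin,
            smul_eq_mul]
          field_simp
          ring
      _ = 8 * C * v * ∑ i ∈ I, r i ^ 2 := by rw [Finset.mul_sum]
      _ ≤ 8 * C * v * δ := by gcongr
      _ ≤ ε := hδ'

/-! ### The divergence theorem on regular regions -/

theorem GaussGreen.of_tsupport_subset_interior {Ω : Set Space} (hΩo : IsOpen Ω) {φ : Space → ℝ}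
    (hφ : ContDiff ℝ 1 φ) (hφc : HasCompactSupport φ) (hsupp : tsupport φ ⊆ Ω) (e : Space) :
    GaussGreen Ω e φ := by
  have h1 : ∫ x in Ω, fderiv ℝ φ x e = ∫ x, fderiv ℝ φ x e := by
    refine setIntegral_eq_integral_of_forall_compl_eq_zero fun x hx => ?_
    rw [fderiv_eq_zero_of_notMem_tsupport fun h => hx (hsupp h)]
    simp
  have h2 : ∫ x, fderiv ℝ φ x e = 0 := by
    have h := integral_mul_fderiv_eq_neg_fderiv_mul_of_integrable (μ := (volume : Measure Space))
      (f := fun _ => (1 : ℝ)) (g := φ) (v := e) (by simp)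
      (by simpa using integrable_fderiv_apply hφ hφc e)
      (by simpa using hφ.continuous.integrable_of_hasCompactSupport hφc)
      (fun x _ => differentiableAt_const _) (fun x _ => hφ.differentiable one_ne_zero x)
    simpa using h
  have h3 : ∫ x in frontier Ω, φ x * inner ℝ (outwardNormal Ω x) e ∂μHE[2] = 0 := by
    refine setIntegral_eq_zero_of_forall_eq_zero fun x hx => ?_
    rw [hΩo.frontier_eq] at hx
    rw [image_eq_zero_of_notMem_tsupport fun h => hx.2 (hsupp h), zero_mul]
  rw [GaussGreen, h1, h2, h3]

theorem GaussGreen.of_tsupport_subset_compl {Ω : Set Space} {φ : Space → ℝ}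
    (hsupp : tsupport φ ⊆ (closure Ω)ᶜ) (e : Space) : GaussGreen Ω e φ := by
  have h1 : ∫ x in Ω, fderiv ℝ φ x e = 0 := by
    refine setIntegral_eq_zero_of_forall_eq_zero fun x hx => ?_
    rw [fderiv_eq_zero_of_notMem_tsupport fun h => hsupp h (subset_closure hx)]
    simp
  have h3 : ∫ x in frontier Ω, φ x * inner ℝ (outwardNormal Ω x) e ∂μHE[2] = 0 := by
    refine setIntegral_eq_zero_of_forall_eq_zero fun x hx => ?_
    rw [image_eq_zero_of_notMem_tsupport fun h => hsupp h (frontier_subset_closure hx), zero_mul]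
  rw [GaussGreen, h1, h3]

/-- The Gauss–Green formula for functions whose support avoids the singular boundary points, by a
partition of unity. -/
theorem IsRegularRegion.gaussGreen_of_tsupport {Ω : Set Space} (hΩ : IsRegularRegion Ω)
    {φ : Space → ℝ} (hφ : ContDiff ℝ 1 φ) (hφc : HasCompactSupport φ)
    (hsupp : ∀ x ∈ tsupport φ, x ∈ frontier Ω → x ∈ regularPoints Ω) (e : Space) :
    GaussGreen Ω e φ := by
  have hloc : ∀ x ∈ tsupport φ, ∃ V, IsOpen V ∧ x ∈ V ∧ ∀ ψ : Space → ℝ, ContDiff ℝ 1 ψ →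
      HasCompactSupport ψ → tsupport ψ ⊆ V → GaussGreen Ω e ψ := fun x hx => by
    by_cases hxf : x ∈ frontier Ω
    · obtain ⟨-, n, hn⟩ := hsupp x hx hxf
      exact hΩ.exists_nhds_gaussGreen hn e
    by_cases hxΩ : x ∈ Ω
    · exact ⟨Ω, hΩ.isOpen, hxΩ, fun ψ h1 h2 h3 =>
        GaussGreen.of_tsupport_subset_interior hΩ.isOpen h1 h2 h3 e⟩
    · refine ⟨(closure Ω)ᶜ, isClosed_closure.isOpen_compl, fun h => hxf ?_, fun ψ _ _ h3 =>
        GaussGreen.of_tsupport_subset_compl h3 e⟩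
      rw [hΩ.isOpen.frontier_eq]
      exact ⟨h, hxΩ⟩
  choose! V hVo hxV hV using hloc
  have hcpt : IsCompact (tsupport φ) := hφc
  obtain ⟨t, htK, htV⟩ := hcpt.elim_nhds_subcover V fun x hx => (hVo x hx).mem_nhds (hxV x hx)
  obtain ⟨p, hp⟩ := SmoothPartitionOfUnity.exists_isSubordinate
    (modelWithCornersSelf ℝ Space) (isClosed_tsupport φ) (fun i : t => V i)
    (fun i => hVo _ (htK _ i.2)) (fun x hx => by
      obtain ⟨i, hi, hxi⟩ := mem_iUnion₂.1 (htV hx)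
      exact mem_iUnion.2 ⟨⟨i, hi⟩, hxi⟩)
  have hpd : ∀ i, ContDiff ℝ 1 (p i) := fun i => (p i).contMDiff.contDiff.of_le (by simp)
  have hsum : φ = fun x => ∑ i ∈ (Finset.univ : Finset t), p i x * φ x := by
    ext x
    by_cases hx : x ∈ tsupport φ
    · rw [← Finset.sum_mul, ← finsum_eq_sum_of_fintype, p.sum_eq_one hx, one_mul]
    · simp [image_eq_zero_of_notMem_tsupport hx]
  rw [hsum]
  refine GaussGreen.sum hΩ (fun i _ => (hpd i).mul hφ) (fun i _ => hφc.mul_left) fun i _ => ?_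
  exact hV _ (htK _ i.2) _ ((hpd i).mul hφ) hφc.mul_left
    ((closure_mono (Function.support_mul_subset_left _ _)).trans (hp i))

/-- The Gauss–Green formula on a regular region: it holds for `η φ`, where `η` cuts off the singular
boundary points, and passes to the limit as the gradients of the cutoffs tend to zero in `L¹`. -/
theorem IsRegularRegion.gaussGreen {Ω : Set Space} (hΩ : IsRegularRegion Ω) {φ : Space → ℝ}
    (hφ : ContDiff ℝ 1 φ) (hφc : HasCompactSupport φ) (e : Space) : GaussGreen Ω e φ := by
  -- The set of singular boundary points is compact and has zero area.
  set K : Set Space := frontier Ω \ regularPoints Ω with hKdef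
  have hK : IsCompact K := by
    obtain ⟨O, hO, hR⟩ := exists_isOpen_regularPoints_eq hΩ.isOpen
    rw [hKdef, hR, sdiff_self_inter]
    exact (isCompact_frontier hΩ.isBounded).diff hO
  have hK0 : μHE[2] K = 0 := by
    have h := (ae_restrict_iff' isClosed_frontier.measurableSet).1 hΩ.ae_normal
    rw [ae_iff] at h
    refine measure_mono_null (fun x hx => ?_) h
    exact fun h' => hx.2 ⟨hx.1, h' hx.1⟩
  have hex := fun k : ℕ => exists_cutoff hK (hausdorffMeasure_two_eq_zero hK0)
    (ε := 1 / ((k : ℝ) + 1)) (by positivity)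
  choose η hηd hη01 hηK hη1 hηi hηε using hex
  have hlim1 : ∀ x ∉ K, ∀ᶠ k in atTop, η k x = 1 := fun x hx => by
    obtain ⟨r, hr, hxr⟩ := Metric.isOpen_iff.1 hK.isClosed.isOpen_compl x hx
    obtain ⟨n, hn⟩ := exists_nat_one_div_lt hr
    filter_upwards [eventually_ge_atTop n] with k hk
    refine hη1 k x fun c hc => ?_
    by_contra hcon
    refine hxr (?_ : c ∈ Metric.ball x r) hc
    rw [Metric.mem_ball, dist_comm]
    refine (not_le.1 hcon).trans (lt_of_le_of_lt ?_ hn)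
    have : (n : ℝ) ≤ k := by exact_mod_cast hk
    gcongr
  have hGG : ∀ k, GaussGreen Ω e fun x => η k x * φ x := fun k => by
    refine hΩ.gaussGreen_of_tsupport ((hηd k).mul hφ) hφc.mul_left (fun x hx hxf => ?_) e
    by_contra hcon
    exact Set.disjoint_left.1 (hηK k) (closure_mono (Function.support_mul_subset_left _ _) hx)
      ⟨hxf, hcon⟩
  have hηb : ∀ k x, ‖η k x‖ ≤ 1 := fun k x => by
    rw [Real.norm_of_nonneg (hη01 k x).1]; exact (hη01 k x).2
  obtain ⟨C, hC⟩ := hφ.continuous.bounded_above_of_compact_support hφc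
  have hC0 : 0 ≤ C := (norm_nonneg _).trans (hC 0)
  -- The boundary terms converge because the singular set has zero area.
  have hR : Tendsto (fun k => ∫ x in frontier Ω,
      (η k x * φ x) * inner ℝ (outwardNormal Ω x) e ∂μHE[2]) atTop
      (𝓝 (∫ x in frontier Ω, φ x * inner ℝ (outwardNormal Ω x) e ∂μHE[2])) := by
    refine tendsto_integral_of_dominated_convergence
      (fun x => ‖φ x * inner ℝ (outwardNormal Ω x) e‖) (fun k => ?_)
      (hΩ.integrableOn_mul_inner hφ.continuous.continuousOn e).norm (fun k => ?_) ?_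
    · exact (hΩ.integrableOn_mul_inner
        ((hηd k).continuous.mul hφ.continuous).continuousOn e).aestronglyMeasurable
    · refine Eventually.of_forall fun x => ?_
      rw [mul_assoc, norm_mul]
      exact mul_le_of_le_one_left (norm_nonneg _) (hηb k x)
    · have : ∀ᵐ x ∂((μHE[2] : Measure Space).restrict (frontier Ω)), x ∉ K := by
        refine ae_restrict_of_ae ?_
        rw [ae_iff]
        simpa using hK0
      filter_upwards [this] with x hx
      refine tendsto_const_nhds.congr' ?_
      filter_upwards [hlim1 x hx] with k hk
      rw [hk, one_mul]
  have hL1 : Tendsto (fun k => ∫ x in Ω, η k x * fderiv ℝ φ x e) atTop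
      (𝓝 (∫ x in Ω, fderiv ℝ φ x e)) := by
    refine tendsto_integral_of_dominated_convergence (fun x => ‖fderiv ℝ φ x e‖) (fun k => ?_)
      (integrable_fderiv_apply hφ hφc e).norm.integrableOn (fun k => ?_) ?_
    · exact ((hηd k).continuous.mul ((hφ.continuous_fderiv one_ne_zero).clm_apply
        continuous_const)).aestronglyMeasurable
    · refine Eventually.of_forall fun x => ?_
      rw [norm_mul]
      exact mul_le_of_le_one_left (norm_nonneg _) (hηb k x)
    · filter_upwards [ae_restrict_mem hΩ.isOpen.measurableSet] with x hx
      have hxK : x ∉ K := fun h => by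
        have := h.1
        rw [hΩ.isOpen.frontier_eq] at this
        exact this.2 hx
      refine tendsto_const_nhds.congr' ?_
      filter_upwards [hlim1 x hxK] with k hk
      rw [hk, one_mul]
  -- The terms with the gradient of the cutoff disappear in the limit.
  have hL2 : Tendsto (fun k => ∫ x in Ω, φ x * fderiv ℝ (η k) x e) atTop (𝓝 0) := by
    have h0 : Tendsto (fun k : ℕ => C * ‖e‖ * (1 / ((k : ℝ) + 1))) atTop (𝓝 0) := by
      simpa using (tendsto_one_div_add_atTop_nhds_zero_nat (𝕜 := ℝ)).const_mul (C * ‖e‖)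
    refine squeeze_zero_norm (fun k => ?_) h0
    have hb : ∀ x, ‖φ x * fderiv ℝ (η k) x e‖ ≤ C * ‖e‖ * ‖fderiv ℝ (η k) x‖ := fun x => by
      rw [norm_mul]
      calc ‖φ x‖ * ‖fderiv ℝ (η k) x e‖ ≤ C * (‖fderiv ℝ (η k) x‖ * ‖e‖) := by
            gcongr
            · exact hC x
            · exact ContinuousLinearMap.le_opNorm _ _
        _ = _ := by ring
    calc ‖∫ x in Ω, φ x * fderiv ℝ (η k) x e‖ ≤ ∫ x in Ω, C * ‖e‖ * ‖fderiv ℝ (η k) x‖ :=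
          norm_integral_le_of_norm_le ((hηi k).const_mul _).integrableOn (Eventually.of_forall hb)
      _ ≤ ∫ x, C * ‖e‖ * ‖fderiv ℝ (η k) x‖ :=
          setIntegral_le_integral ((hηi k).const_mul _)
            (Eventually.of_forall fun x => by positivity)
      _ = C * ‖e‖ * ∫ x, ‖fderiv ℝ (η k) x‖ := integral_const_mul _ _
      _ ≤ C * ‖e‖ * (1 / ((k : ℝ) + 1)) := by gcongr; exact hηε k
  have hsplit : ∀ k, ∫ x in Ω, fderiv ℝ (fun x => η k x * φ x) x e =
      (∫ x in Ω, η k x * fderiv ℝ φ x e) + ∫ x in Ω, φ x * fderiv ℝ (η k) x e := fun k => by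
    rw [← integral_add]
    · refine integral_congr_ae (Eventually.of_forall fun x => ?_)
      simp only
      rw [fderiv_fun_mul ((hηd k).differentiable one_ne_zero x) (hφ.differentiable one_ne_zero x)]
      rfl
    · exact (((hηd k).continuous.mul ((hφ.continuous_fderiv one_ne_zero).clm_apply
        continuous_const)).integrable_of_hasCompactSupport
          ((hφc.fderiv_apply (𝕜 := ℝ) e).mul_left)).integrableOn
    · exact ((hφ.continuous.mul (((hηd k).continuous_fderiv one_ne_zero).clm_apply
        continuous_const)).integrable_of_hasCompactSupport hφc.mul_right).integrableOn
  have hlim := hL1.add hL2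
  rw [add_zero] at hlim
  refine tendsto_nhds_unique hlim (hR.congr fun k => ?_)
  rw [← hsplit k]
  exact (hGG k).symm

/-- The divergence of a vector field. -/
noncomputable def divergence (a : Space → Space) (x : Space) : ℝ :=
  LinearMap.trace ℝ Space (fderiv ℝ a x : Space →ₗ[ℝ] Space)

/-- The divergence theorem: the flux of a `C¹` field through the boundary of a regular region is the
volume integral of its divergence. -/
theorem IsRegularRegion.boundaryFlux_eq {Ω U : Set Space} (hΩ : IsRegularRegion Ω)
    (hU : IsOpen U) (hΩU : closure Ω ⊆ U) {a : Space → Space} (ha : ContDiffOn ℝ 1 a U) :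
    boundaryFlux Ω a = ∫ x in Ω, divergence a x := by
  have hcl : IsCompact (closure Ω) := hΩ.isBounded.isCompact_closure
  obtain ⟨K, hK, hΩK, hKU⟩ := exists_compact_between hcl hU hΩU
  -- A smooth function that is one near the closure of the region, with support in `K`.
  obtain ⟨p, hp1, hp0, -⟩ := exists_contMDiffMap_one_nhds_of_subset_interior (n := 1)
    (modelWithCornersSelf ℝ Space) isClosed_closure hΩK
  have hpd : ContDiff ℝ 1 p := p.contMDiff.contDiff
  have hpK : tsupport p ⊆ K :=
    closure_minimal (fun x hx => by_contra fun h => hx (hp0 x h)) hK.isClosed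
  have hpc : HasCompactSupport p := hK.of_isClosed_subset (isClosed_tsupport _) hpK
  have hp1' : ∀ x ∈ closure Ω, ∀ᶠ y in 𝓝 x, p y = 1 := fun x hx =>
    hp1.filter_mono (nhds_le_nhdsSet hx)
  let b := EuclideanSpace.basisFun (Fin 3) ℝ
  set ψ : Fin 3 → Space → ℝ := fun i x => p x * inner ℝ (b i) (a x) with hψ
  have hψd : ∀ i, ContDiff ℝ 1 (ψ i) := fun i => by
    rw [contDiff_iff_contDiffAt]
    intro x
    by_cases hx : x ∈ tsupport p
    · exact hpd.contDiffAt.mul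
        (contDiffAt_const.inner ℝ (ha.contDiffAt (hU.mem_nhds (hKU (hpK hx)))))
    · refine (contDiffAt_const (c := (0 : ℝ))).congr_of_eventuallyEq ?_
      filter_upwards [notMem_tsupport_iff_eventuallyEq.1 hx] with y hy
      simp [hψ, hy]
  have hψc : ∀ i, HasCompactSupport (ψ i) := fun i => hpc.mul_right
  have hdiv : ∀ x ∈ Ω, divergence a x = ∑ i, fderiv ℝ (ψ i) x (b i) := fun x hx => by
    have hxU := hΩU (subset_closure hx)
    rw [divergence, LinearMap.trace_eq_sum_inner _ b]
    refine Finset.sum_congr rfl fun i _ => ?_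
    have had : HasFDerivAt a (fderiv ℝ a x) x :=
      ((ha.contDiffAt (hU.mem_nhds hxU)).differentiableAt one_ne_zero).hasFDerivAt
    have h1 : HasFDerivAt (fun y => inner ℝ (b i) (a y)) ((innerSL ℝ (b i)) ∘L fderiv ℝ a x) x :=
      (innerSL ℝ (b i)).hasFDerivAt.comp x had
    have h2 : ψ i =ᶠ[𝓝 x] fun y => inner ℝ (b i) (a y) := by
      filter_upwards [hp1' x (subset_closure hx)] with y hy
      simp [hψ, hy]
    rw [(h1.congr_of_eventuallyEq h2).fderiv]
    rfl
  have hflux : ∀ x ∈ frontier Ω, inner ℝ (a x) (outwardNormal Ω x) =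
      ∑ i, ψ i x * inner ℝ (outwardNormal Ω x) (b i) := fun x hx => by
    have hpx : p x = 1 := (hp1' x (frontier_subset_closure hx)).self_of_nhds
    rw [← b.sum_inner_mul_inner (a x) (outwardNormal Ω x)]
    refine Finset.sum_congr rfl fun i _ => ?_
    simp only [hψ, hpx, one_mul]
    rw [real_inner_comm, real_inner_comm (b i)]
  rw [boundaryFlux, setIntegral_congr_fun isClosed_frontier.measurableSet hflux,
    setIntegral_congr_fun hΩ.isOpen.measurableSet hdiv,
    integral_finsetSum _ fun i _ => hΩ.integrableOn_mul_inner (hψd i).continuous.continuousOn (b i),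
    integral_finsetSum _ fun i _ => (integrable_fderiv_apply (hψd i) (hψc i) (b i)).integrableOn]
  exact Finset.sum_congr rfl fun i _ => (hΩ.gaussGreen (hψd i) (hψc i) (b i)).symm

/-! ### Calculus of determinants and the Piola identity -/

theorem contDiff_det {n : WithTop ℕ∞} : ContDiff ℝ n fun A : Tensor => A.det := by
  let b := (EuclideanSpace.basisFun (Fin 3) ℝ).toBasis
  have h : (fun A : Tensor => A.det) =
      fun A : Tensor => (LinearMap.toMatrix b b (A : Space →ₗ[ℝ] Space)).det := by
    ext A
    rw [LinearMap.det_toMatrix]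
  rw [h]
  have hc : ∀ i j, ContDiff ℝ n fun A : Tensor =>
      LinearMap.toMatrix b b (A : Space →ₗ[ℝ] Space) i j := fun i j => by
    have h1 : (fun A : Tensor => LinearMap.toMatrix b b (A : Space →ₗ[ℝ] Space) i j) =
        fun A : Tensor => (A (b j)) i := by
      ext A
      simp [LinearMap.toMatrix_apply, b]
    rw [h1]
    have h2 : ContDiff ℝ n fun A : Tensor => A (b j) := contDiff_id.clm_apply contDiff_const
    exact (contDiff_piLp_apply (p := 2) (i := i)).comp h2
  simp only [Matrix.det_fin_three]
  exact ((((((hc 0 0).mul (hc 1 1)).mul (hc 2 2)).sub (((hc 0 0).mul (hc 1 2)).mul (hc 2 1))).sub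
    (((hc 0 1).mul (hc 1 0)).mul (hc 2 2))).add (((hc 0 1).mul (hc 1 2)).mul (hc 2 0))).add
    (((hc 0 2).mul (hc 1 0)).mul (hc 2 1)) |>.sub (((hc 0 2).mul (hc 1 1)).mul (hc 2 0))

/-- The trace of a tensor. -/
noncomputable abbrev tr (A : Tensor) : ℝ := LinearMap.trace ℝ Space (A : Space →ₗ[ℝ] Space)

theorem tr_comp_comm (A B : Tensor) : tr (A ∘L B) = tr (B ∘L A) :=
  LinearMap.trace_mul_comm ℝ (A : Space →ₗ[ℝ] Space) (B : Space →ₗ[ℝ] Space)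

theorem tr_smulRight (f : Space →L[ℝ] ℝ) (w : Space) : tr (f.smulRight w) = f w :=
  LinearMap.trace_smulRight (R := ℝ) (f : Space →ₗ[ℝ] ℝ) w

theorem continuous_tr : Continuous fun A : Tensor => tr A :=
  ((LinearMap.trace ℝ Space).comp
    (ContinuousLinearMap.coeLM ℝ : Tensor →ₗ[ℝ] _)).continuous_of_finiteDimensional

theorem hasDerivAt_det_one_add_smul (B : Tensor) :
    HasDerivAt (fun s : ℝ => (1 + s • B : Tensor).det) (tr B) 0 := by
  let b := (EuclideanSpace.basisFun (Fin 3) ℝ).toBasis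
  set M := LinearMap.toMatrix b b (B : Space →ₗ[ℝ] Space) with hM
  have h : ∀ s : ℝ, (1 + s • B : Tensor).det = (1 + s • M).det := fun s => by
    have h1 : (1 + s • M) =
        LinearMap.toMatrix b b ((1 + s • B : Tensor) : Space →ₗ[ℝ] Space) := by
      rw [hM, ← LinearMap.toMatrix_one b, ← map_smul, ← map_add]
      rfl
    rw [h1, LinearMap.det_toMatrix]
  have ht : tr B = M.trace := LinearMap.trace_eq_matrix_trace ℝ b _
  set q := (1 + (Polynomial.X : Polynomial ℝ) • M.map ⇑(Polynomial.C (R := ℝ))).det.divX.divX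
    with hq
  have hfun : (fun s : ℝ => (1 + s • B : Tensor).det) =
      fun s => 1 + M.trace * s + q.eval s * s ^ 2 := by
    ext s
    rw [h, Matrix.det_one_add_smul, hq]
  rw [ht, hfun]
  have h1 := ((hasDerivAt_const (0 : ℝ) (1 : ℝ)).add
    ((hasDerivAt_id (0 : ℝ)).const_mul M.trace)).add
    ((q.hasDerivAt 0).mul ((hasDerivAt_id (0 : ℝ)).pow 2))
  convert! h1 using 1
  simp

theorem isUnit_of_det_ne_zero {A : Tensor} (hA : A.det ≠ 0) : IsUnit A := by
  have h1 : IsUnit (LinearMap.det (A : Space →ₗ[ℝ] Space)) := isUnit_iff_ne_zero.2 hA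
  have h2 : IsUnit (A : Space →ₗ[ℝ] Space) := (LinearMap.isUnit_iff_isUnit_det _).2 h1
  have h3 := h2.map (Module.End.toContinuousLinearMap Space)
  exact h3

theorem det_eq_mul_det_one_add {A : Tensor} (u : Tensorˣ) (hu : (u : Tensor) = A) (H : Tensor)
    (s : ℝ) : (A + s • H).det = A.det * (1 + s • ((↑u⁻¹ : Tensor) ∘L H) : Tensor).det := by
  have h : A + s • H = A ∘L (1 + s • ((↑u⁻¹ : Tensor) ∘L H) : Tensor) := by
    have h1 : A ∘L (↑u⁻¹ : Tensor) = 1 := by rw [← hu]; exact u.mul_inv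
    rw [ContinuousLinearMap.comp_add, ContinuousLinearMap.comp_smul,
      ← ContinuousLinearMap.comp_assoc, h1]
    rfl
  rw [h]
  exact LinearMap.det_comp _ _

/-- Jacobi's formula for the derivative of the determinant at an invertible tensor. -/
theorem fderiv_det_apply {A : Tensor} (hA : A.det ≠ 0) (H : Tensor) :
    fderiv ℝ (fun A : Tensor => A.det) A H = A.det * tr (ContinuousLinearMap.inverse A ∘L H) := by
  obtain ⟨u, hu⟩ := isUnit_of_det_ne_zero hA
  have hinv : ContinuousLinearMap.inverse A = (↑u⁻¹ : Tensor) := by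
    rw [← ContinuousLinearMap.ringInverse_eq_inverse, ← hu, Ring.inverse_unit]
  have h1 : HasDerivAt (fun s : ℝ => A + s • H) H 0 := by
    simpa using ((hasDerivAt_id (0 : ℝ)).smul_const H).const_add A
  have h2 : HasFDerivAt (fun A : Tensor => A.det) (fderiv ℝ (fun A : Tensor => A.det) A)
      (A + (0 : ℝ) • H) := by
    have h0 : A + (0 : ℝ) • H = A := by rw [zero_smul ℝ H, add_zero]
    rw [h0]
    exact ((contDiff_det (n := 1)).differentiable one_ne_zero A).hasFDerivAt
  have h3 : HasDerivAt ((fun A : Tensor => A.det) ∘ fun s : ℝ => A + s • H)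
      (fderiv ℝ (fun A : Tensor => A.det) A H) 0 := HasFDerivAt.comp_hasDerivAt 0 h2 h1
  have h4 := (hasDerivAt_det_one_add_smul ((↑u⁻¹ : Tensor) ∘L H)).const_mul A.det
  simp only [← det_eq_mul_det_one_add u hu] at h4
  rw [h3.unique h4, hinv]

theorem inverse_comp_self {A : Tensor} (hA : A.det ≠ 0) :
    ContinuousLinearMap.inverse A ∘L A = 1 := by
  obtain ⟨u, hu⟩ := isUnit_of_det_ne_zero hA
  rw [← ContinuousLinearMap.ringInverse_eq_inverse, ← hu, Ring.inverse_unit]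
  exact u.inv_mul

theorem self_comp_inverse {A : Tensor} (hA : A.det ≠ 0) :
    A ∘L ContinuousLinearMap.inverse A = 1 := by
  obtain ⟨u, hu⟩ := isUnit_of_det_ne_zero hA
  rw [← ContinuousLinearMap.ringInverse_eq_inverse, ← hu, Ring.inverse_unit]
  exact u.mul_inv

theorem contDiffAt_inverse {A : Tensor} (hA : A.det ≠ 0) {n : WithTop ℕ∞} :
    ContDiffAt ℝ n (fun A : Tensor => ContinuousLinearMap.inverse A) A := by
  obtain ⟨u, hu⟩ := isUnit_of_det_ne_zero hA
  have h := contDiffAt_ringInverse ℝ (n := n) u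
  rwa [hu, ContinuousLinearMap.ringInverse_eq_inverse] at h

theorem fderiv_inverse_apply {A : Tensor} (hA : A.det ≠ 0) (H : Tensor) :
    fderiv ℝ (fun A : Tensor => ContinuousLinearMap.inverse A) A H =
      -(ContinuousLinearMap.inverse A ∘L H ∘L ContinuousLinearMap.inverse A) := by
  obtain ⟨u, hu⟩ := isUnit_of_det_ne_zero hA
  have h := hasFDerivAt_ringInverse (𝕜 := ℝ) u
  have hinv : ContinuousLinearMap.inverse A = (↑u⁻¹ : Tensor) := by
    rw [← ContinuousLinearMap.ringInverse_eq_inverse, ← hu, Ring.inverse_unit]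
  rw [hu, ContinuousLinearMap.ringInverse_eq_inverse] at h
  rw [h.fderiv, hinv]
  simp [ContinuousLinearMap.mulLeftRight_apply, ContinuousLinearMap.mul_def,
    ContinuousLinearMap.comp_assoc]

theorem divergence_smul {f : Space → ℝ} {a : Space → Space} {x : Space}
    (hf : DifferentiableAt ℝ f x) (ha : DifferentiableAt ℝ a x) :
    divergence (fun y => f y • a y) x = fderiv ℝ f x (a x) + f x * divergence a x := by
  have h : fderiv ℝ (fun y => f y • a y) x = f x • fderiv ℝ a x + (fderiv ℝ f x).smulRight (a x) :=
    (hf.hasFDerivAt.smul ha.hasFDerivAt).fderiv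
  change tr (fderiv ℝ (fun y => f y • a y) x) = _ + f x * tr (fderiv ℝ a x)
  rw [h]
  have h2 : tr (f x • fderiv ℝ a x + (fderiv ℝ f x).smulRight (a x)) =
      f x • tr (fderiv ℝ a x) + tr ((fderiv ℝ f x).smulRight (a x)) := by
    simp only [tr, ContinuousLinearMap.toLinearMap_add, ContinuousLinearMap.toLinearMap_smul,
      map_add, map_smul]
  rw [h2, tr_smulRight, smul_eq_mul, add_comm]

theorem continuousOn_divergence {a : Space → Space} {U : Set Space} (hU : IsOpen U)
    (ha : ContDiffOn ℝ 1 a U) : ContinuousOn (divergence a) U :=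
  continuous_tr.comp_continuousOn (ha.continuousOn_fderiv_of_isOpen hU le_rfl)

/-- The Piola transform `J F⁻¹ a` of a spatial vector field `a`. -/
noncomputable def piola (χ : Space → Space) (a : Space → Space) (X : Space) : Space :=
  (fderiv ℝ χ X).det • ContinuousLinearMap.inverse (fderiv ℝ χ X) (a (χ X))

theorem contDiffAt_piola {χ a : Space → Space} {X : Space} (hχ : ContDiffAt ℝ 2 χ X)
    (hdet : (fderiv ℝ χ X).det ≠ 0) (ha : ContDiffAt ℝ 1 a (χ X)) :
    ContDiffAt ℝ 1 (piola χ a) X := by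
  have hF : ContDiffAt ℝ 1 (fderiv ℝ χ) X := hχ.fderiv_right (by norm_num)
  have h1 : ContDiffAt ℝ 1 (fun Y => (fderiv ℝ χ Y).det) X :=
    contDiff_det.contDiffAt.comp X hF
  have h2 : ContDiffAt ℝ 1 (fun Y => ContinuousLinearMap.inverse (fderiv ℝ χ Y)) X :=
    (contDiffAt_inverse hdet).comp X hF
  exact h1.smul (h2.clm_apply (ha.comp X (hχ.of_le (by norm_num))))

/-- The Piola identity: the divergence of the Piola transform is `J` times the spatial divergence.
The two terms with derivatives of the deformation gradient cancel, by Jacobi's formula and the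
symmetry of the second derivative of the deformation. -/
theorem divergence_piola {χ a : Space → Space} {X : Space} (hχ : ContDiffAt ℝ 2 χ X)
    (hdet : (fderiv ℝ χ X).det ≠ 0) (ha : DifferentiableAt ℝ a (χ X)) :
    divergence (piola χ a) X = (fderiv ℝ χ X).det * divergence a (χ X) := by
  set F := fderiv ℝ χ X
  set G := ContinuousLinearMap.inverse F
  set J := F.det
  set w := G (a (χ X)) with hw
  set F' := fderiv ℝ (fderiv ℝ χ) X with hF'
  set L := fderiv ℝ a (χ X)
  have hF : HasFDerivAt (fderiv ℝ χ) F' X :=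
    ((hχ.fderiv_right (m := 1) (by norm_num)).differentiableAt one_ne_zero).hasFDerivAt
  have hsymm : ∀ H, F' H w = F' w H := fun H =>
    (hχ.isSymmSndFDerivAt (by simp)) H w
  have hχd : HasFDerivAt χ F X := (hχ.differentiableAt (by norm_num)).hasFDerivAt
  have h1 : HasFDerivAt (fun Y => (fderiv ℝ χ Y).det)
      (fderiv ℝ (fun A : Tensor => A.det) F ∘L F') X :=
    ((contDiff_det (n := 1)).differentiable one_ne_zero F).hasFDerivAt.comp X hF
  have h2 : HasFDerivAt (fun Y => ContinuousLinearMap.inverse (fderiv ℝ χ Y))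
      (fderiv ℝ (fun A : Tensor => ContinuousLinearMap.inverse A) F ∘L F') X :=
    ((contDiffAt_inverse hdet (n := 1)).differentiableAt one_ne_zero).hasFDerivAt.comp X hF
  have h3 : HasFDerivAt (fun Y => a (χ Y)) (L ∘L F) X := ha.hasFDerivAt.comp X hχd
  have h4 := h1.smul (h2.clm_apply h3)
  have h5 : fderiv ℝ (piola χ a) X = J • (-(G ∘L F' w) + G ∘L L ∘L F) +
      (fderiv ℝ (fun A : Tensor => A.det) F ∘L F').smulRight w := by
    have h6 : fderiv ℝ (piola χ a) X = _ := h4.fderiv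
    rw [h6]
    ext1 H
    have h8 : fderiv ℝ (fun A : Tensor => ContinuousLinearMap.inverse A) F (F' H) =
        -(G ∘L F' H ∘L G) := fderiv_inverse_apply hdet (F' H)
    simp only [add_apply, smul_apply, ContinuousLinearMap.smulRight_apply,
      ContinuousLinearMap.comp_apply, ContinuousLinearMap.flip_apply, neg_apply, h8]
    rw [← hw, hsymm H, add_comm (G _)]
  have hFG : F ∘L G = 1 := self_comp_inverse hdet
  have htr : tr (G ∘L L ∘L F) = tr L := by
    rw [tr_comp_comm, ContinuousLinearMap.comp_assoc, hFG]
    rfl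
  change tr (fderiv ℝ (piola χ a) X) = J * tr L
  rw [h5]
  have h9 : ∀ (A B : Tensor) (C : Tensor), tr (J • (-A + B) + C) = J * (-tr A + tr B) + tr C := by
    intro A B C
    simp only [tr, ContinuousLinearMap.toLinearMap_add, ContinuousLinearMap.toLinearMap_smul,
      ContinuousLinearMap.toLinearMap_neg, map_add, map_smul, map_neg, smul_eq_mul]
  rw [h9, htr, tr_smulRight, ContinuousLinearMap.comp_apply, fderiv_det_apply hdet]
  ring

/-! ### Kinematics of a constituent -/

namespace Constituent

variable {times : Set ℝ} (C : Constituent times)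

/-- The motion as a map of space-time. -/
noncomputable def spaceTime (p : Space × ℝ) : Space × ℝ := (C.motion p.1 p.2, p.2)

/-- The part of space-time engaged by the constituent. -/
def engaged : Set (Space × ℝ) := {q | q.2 ∈ times ∧ q.1 ∈ C.region q.2}

variable {C}

theorem contDiffAt_motion_uncurry (ht : IsOpen times) {p : Space × ℝ} (hp : p ∈ C.body ×ˢ times) :
    ContDiffAt ℝ 2 (fun p : Space × ℝ => C.motion p.1 p.2) p :=
  C.contDiffOn_motion.contDiffAt ((C.isOpen_body.prod ht).mem_nhds hp)

theorem contDiffAt_motion (ht : IsOpen times) {X : Space} {t : ℝ} (hX : X ∈ C.body)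
    (htt : t ∈ times) : ContDiffAt ℝ 2 (fun Y => C.motion Y t) X :=
  ContDiffAt.comp X (contDiffAt_motion_uncurry ht (p := (X, t)) ⟨hX, htt⟩)
    (contDiffAt_id.prodMk contDiffAt_const)

theorem defGrad_eq (ht : IsOpen times) {p : Space × ℝ} (hp : p ∈ C.body ×ˢ times) :
    C.defGrad p.1 p.2 =
      fderiv ℝ (fun p : Space × ℝ => C.motion p.1 p.2) p ∘L .inl ℝ Space ℝ := by
  have h1 : HasFDerivAt (fun Y : Space => ((Y, p.2) : Space × ℝ)) (.inl ℝ Space ℝ) p.1 :=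
    hasFDerivAt_prodMk_left p.1 p.2
  have h2 := ((contDiffAt_motion_uncurry ht hp).differentiableAt (by norm_num)).hasFDerivAt
  exact (HasFDerivAt.comp p.1 h2 h1).fderiv

theorem hasDerivAt_motion (ht : IsOpen times) {p : Space × ℝ} (hp : p ∈ C.body ×ˢ times) :
    HasDerivAt (fun τ => C.motion p.1 τ)
      (fderiv ℝ (fun p : Space × ℝ => C.motion p.1 p.2) p (0, 1)) p.2 := by
  have h1 : HasDerivAt (fun τ : ℝ => ((p.1, τ) : Space × ℝ)) (0, 1) p.2 :=
    (hasDerivAt_const p.2 p.1).prodMk (hasDerivAt_id p.2)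
  have h2 := ((contDiffAt_motion_uncurry ht hp).differentiableAt (by norm_num)).hasFDerivAt
  exact HasFDerivAt.comp_hasDerivAt p.2 h2 h1

theorem refVelocity_eq (ht : IsOpen times) {p : Space × ℝ} (hp : p ∈ C.body ×ˢ times) :
    C.refVelocity p.1 p.2 = fderiv ℝ (fun p : Space × ℝ => C.motion p.1 p.2) p (0, 1) :=
  (hasDerivAt_motion ht hp).deriv

theorem contDiffAt_defGrad (ht : IsOpen times) {p : Space × ℝ} (hp : p ∈ C.body ×ˢ times) :
    ContDiffAt ℝ 1 (fun p : Space × ℝ => C.defGrad p.1 p.2) p := by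
  have h1 : ContDiffAt ℝ 1 (fderiv ℝ fun p : Space × ℝ => C.motion p.1 p.2) p :=
    (contDiffAt_motion_uncurry ht hp).fderiv_right (by norm_num)
  refine (h1.clm_comp (g := fun p => fderiv ℝ (fun p : Space × ℝ => C.motion p.1 p.2) p)
    (f := fun _ => ContinuousLinearMap.inl ℝ Space ℝ) contDiffAt_const).congr_of_eventuallyEq ?_
  filter_upwards [(C.isOpen_body.prod ht).mem_nhds hp] with q hq using defGrad_eq ht hq

theorem contDiffAt_refVelocity (ht : IsOpen times) {p : Space × ℝ} (hp : p ∈ C.body ×ˢ times) :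
    ContDiffAt ℝ 1 (fun p : Space × ℝ => C.refVelocity p.1 p.2) p := by
  have h1 : ContDiffAt ℝ 1 (fderiv ℝ fun p : Space × ℝ => C.motion p.1 p.2) p :=
    (contDiffAt_motion_uncurry ht hp).fderiv_right (by norm_num)
  refine (h1.clm_apply (contDiffAt_const (c := ((0, 1) : Space × ℝ)))).congr_of_eventuallyEq ?_
  filter_upwards [(C.isOpen_body.prod ht).mem_nhds hp] with q hq using refVelocity_eq ht hq

/-- The rate of change of the deformation gradient is the referential gradient of the velocity. -/
theorem hasDerivAt_defGrad (ht : IsOpen times) {X : Space} {t : ℝ} (hX : X ∈ C.body)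
    (htt : t ∈ times) :
    HasDerivAt (fun τ => C.defGrad X τ) (fderiv ℝ (fun Y => C.refVelocity Y t) X) t := by
  have hp : (X, t) ∈ C.body ×ˢ times := ⟨hX, htt⟩
  have hm := contDiffAt_motion_uncurry ht hp
  set D := fderiv ℝ fun p : Space × ℝ => C.motion p.1 p.2
  have hD' : HasFDerivAt D (fderiv ℝ D (X, t)) (X, t) :=
    ((hm.fderiv_right (m := 1) (by norm_num)).differentiableAt one_ne_zero).hasFDerivAt
  have h1 : HasDerivAt (fun τ : ℝ => ((X, τ) : Space × ℝ)) (0, 1) t :=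
    (hasDerivAt_const t X).prodMk (hasDerivAt_id t)
  have h2 : HasFDerivAt (fun Y : Space => ((Y, t) : Space × ℝ)) (.inl ℝ Space ℝ) X :=
    hasFDerivAt_prodMk_left X t
  have h3 : HasDerivAt (fun τ => D (X, τ) ∘L .inl ℝ Space ℝ)
      (fderiv ℝ D (X, t) (0, 1) ∘L .inl ℝ Space ℝ) t :=
    ((ContinuousLinearMap.compL ℝ Space (Space × ℝ) Space).flip
      (.inl ℝ Space ℝ)).hasFDerivAt.comp_hasDerivAt t (HasFDerivAt.comp_hasDerivAt t hD' h1)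
  have h4 : HasFDerivAt (fun Y => D (Y, t) (0, 1))
      ((ContinuousLinearMap.apply ℝ Space ((0, 1) : Space × ℝ)) ∘L
        (fderiv ℝ D (X, t) ∘L .inl ℝ Space ℝ)) X :=
    (ContinuousLinearMap.apply ℝ Space ((0, 1) : Space × ℝ)).hasFDerivAt.comp X
      (HasFDerivAt.comp X hD' h2)
  have h5 : HasFDerivAt (fun Y => C.refVelocity Y t)
      ((ContinuousLinearMap.apply ℝ Space ((0, 1) : Space × ℝ)) ∘L
        (fderiv ℝ D (X, t) ∘L .inl ℝ Space ℝ)) X := by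
    refine h4.congr_of_eventuallyEq ?_
    filter_upwards [C.isOpen_body.mem_nhds hX] with Y hY using
      refVelocity_eq ht (p := (Y, t)) ⟨hY, htt⟩
  have h6 : HasDerivAt (fun τ => C.defGrad X τ)
      (fderiv ℝ D (X, t) (0, 1) ∘L .inl ℝ Space ℝ) t := by
    refine h3.congr_of_eventuallyEq ?_
    filter_upwards [ht.mem_nhds htt] with τ hτ using defGrad_eq ht (p := (X, τ)) ⟨hX, hτ⟩
  rw [h5.fderiv]
  convert! h6 using 1
  ext1 H
  exact (hm.isSymmSndFDerivAt (by simp)) (H, 0) (0, 1)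

theorem particle_mem {x : Space} {t : ℝ} (hx : x ∈ C.region t) : C.particle x t ∈ C.body :=
  Function.invFunOn_mem hx

theorem motion_particle {x : Space} {t : ℝ} (hx : x ∈ C.region t) :
    C.motion (C.particle x t) t = x :=
  Function.invFunOn_eq (f := fun X => C.motion X t) hx

theorem motion_mem_region {X : Space} (t : ℝ) (hX : X ∈ C.body) : C.motion X t ∈ C.region t :=
  mem_image_of_mem _ hX

theorem particle_motion {X : Space} {t : ℝ} (hX : X ∈ C.body) (htt : t ∈ times) :
    C.particle (C.motion X t) t = X :=
  C.injOn_motion t htt (particle_mem (motion_mem_region t hX)) hX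
    (motion_particle (motion_mem_region t hX))

/-- By the inverse function theorem, the engaged part of space-time is open and the particle at a
place depends on place and time in a twice continuously differentiable way. -/
theorem engaged_mem_nhds_and_contDiffAt_particle (ht : IsOpen times) {q : Space × ℝ}
    (hq : q ∈ C.engaged) :
    C.engaged ∈ 𝓝 q ∧ ContDiffAt ℝ 2 (fun q : Space × ℝ => C.particle q.1 q.2) q := by
  obtain ⟨hqt, X, hX, hXq⟩ := hq
  have hXq : C.motion X q.2 = q.1 := hXq
  have hp : (X, q.2) ∈ C.body ×ˢ times := ⟨hX, hqt⟩
  have hΦp : C.spaceTime (X, q.2) = q := Prod.ext hXq rfl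
  have hm := contDiffAt_motion_uncurry ht hp
  set D := fderiv ℝ (fun p : Space × ℝ => C.motion p.1 p.2) (X, q.2)
  have hΦ : ContDiffAt ℝ 2 C.spaceTime (X, q.2) := hm.prodMk contDiffAt_snd
  have hΦ' : HasFDerivAt C.spaceTime (D.prod (.snd ℝ Space ℝ)) (X, q.2) :=
    (hm.differentiableAt (by norm_num)).hasFDerivAt.prodMk hasFDerivAt_snd
  have hdet : (C.defGrad X q.2).det ≠ 0 := (C.det_pos X hX q.2 hqt).ne'
  have hF : C.defGrad X q.2 = D ∘L .inl ℝ Space ℝ := defGrad_eq ht hp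
  have hinj : Function.Injective (D.prod (.snd ℝ Space ℝ)) := by
    rw [injective_iff_map_eq_zero]
    rintro ⟨H, s⟩ h
    have hs : s = 0 := congr($h.2)
    subst hs
    have h1 : C.defGrad X q.2 H = 0 := by rw [hF]; exact congr($h.1)
    have h2 := congr($(inverse_comp_self hdet) H)
    rw [ContinuousLinearMap.comp_apply, h1, map_zero] at h2
    exact Prod.ext h2.symm rfl
  let e : (Space × ℝ) ≃L[ℝ] (Space × ℝ) :=
    (LinearEquiv.ofInjectiveEndo _ hinj).toContinuousLinearEquiv
  have hΦe : HasFDerivAt C.spaceTime (e : (Space × ℝ) →L[ℝ] (Space × ℝ)) (X, q.2) := by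
    convert! hΦ' using 1
  let g := hΦ.localInverse hΦe (by norm_num)
  have hg : ContDiffAt ℝ 2 g (C.spaceTime (X, q.2)) := hΦ.to_localInverse hΦe (by norm_num)
  have hgq : g (C.spaceTime (X, q.2)) = (X, q.2) := hΦ.localInverse_apply_image hΦe (by norm_num)
  have hright : ∀ᶠ y in 𝓝 (C.spaceTime (X, q.2)), C.spaceTime (g y) = y :=
    (hΦ.hasStrictFDerivAt' hΦe (by norm_num)).eventually_right_inverse
  have hmem : ∀ᶠ y in 𝓝 (C.spaceTime (X, q.2)), g y ∈ C.body ×ˢ times :=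
    hg.continuousAt.eventually_mem (by
      rw [hgq]; exact (C.isOpen_body.prod ht).mem_nhds hp)
  rw [hΦp] at hg hright hmem
  have key : ∀ᶠ y in 𝓝 q, y ∈ C.engaged ∧ C.particle y.1 y.2 = (g y).1 := by
    filter_upwards [hright, hmem] with y hy hyB
    have h2 : (g y).2 = y.2 := congr($hy.2)
    have h1 : C.motion (g y).1 y.2 = y.1 := by rw [← h2]; exact congr($hy.1)
    have ht' : y.2 ∈ times := h2 ▸ hyB.2
    refine ⟨⟨ht', (g y).1, hyB.1, h1⟩, ?_⟩
    rw [← h1]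
    exact particle_motion hyB.1 ht'
  exact ⟨key.mono fun y hy => hy.1,
    hg.fst.congr_of_eventuallyEq (key.mono fun y hy => hy.2)⟩

theorem isOpen_engaged (ht : IsOpen times) : IsOpen C.engaged :=
  isOpen_iff_mem_nhds.2 fun _ hq => (engaged_mem_nhds_and_contDiffAt_particle ht hq).1

theorem isOpen_region (ht : IsOpen times) {t : ℝ} (htt : t ∈ times) : IsOpen (C.region t) := by
  have h : C.region t = (fun x : Space => (x, t)) ⁻¹' C.engaged := by
    ext x
    exact ⟨fun h => ⟨htt, h⟩, fun h => h.2⟩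
  rw [h]
  exact (isOpen_engaged ht).preimage (by fun_prop)

theorem contDiffAt_particle_prod (ht : IsOpen times) {q : Space × ℝ} (hq : q ∈ C.engaged) :
    ContDiffAt ℝ 1 (fun q : Space × ℝ => ((C.particle q.1 q.2, q.2) : Space × ℝ)) q :=
  ((engaged_mem_nhds_and_contDiffAt_particle ht hq).2.of_le (by norm_num)).prodMk contDiffAt_snd

theorem particle_prod_mem {q : Space × ℝ} (hq : q ∈ C.engaged) :
    ((C.particle q.1 q.2, q.2) : Space × ℝ) ∈ C.body ×ˢ times :=
  ⟨particle_mem hq.2, hq.1⟩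

theorem contDiffAt_velocity (ht : IsOpen times) {q : Space × ℝ} (hq : q ∈ C.engaged) :
    ContDiffAt ℝ 1 (fun q : Space × ℝ => C.velocity q.1 q.2) q :=
  ContDiffAt.comp q (contDiffAt_refVelocity ht (particle_prod_mem hq))
    (contDiffAt_particle_prod ht hq)

theorem contDiffAt_bulkVolume (ht : IsOpen times) {q : Space × ℝ} (hq : q ∈ C.engaged) :
    ContDiffAt ℝ 1 (fun q : Space × ℝ => C.bulkVolume q.1 q.2) q := by
  have h1 : ContDiffAt ℝ 1 (fun q : Space × ℝ => C.defGrad (C.particle q.1 q.2) q.2) q :=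
    ContDiffAt.comp q (contDiffAt_defGrad ht (particle_prod_mem hq))
      (contDiffAt_particle_prod ht hq)
  have h2 : ContDiffAt ℝ 1 (fun q : Space × ℝ => (C.defGrad (C.particle q.1 q.2) q.2).det) q :=
    contDiff_det.contDiffAt.comp q h1
  exact contDiffAt_const.div h2 (C.det_pos _ (particle_mem hq.2) _ hq.1).ne'

theorem contDiffOn_velocity (ht : IsOpen times) {t : ℝ} (htt : t ∈ times) :
    ContDiffOn ℝ 1 (fun x => C.velocity x t) (C.region t) := fun x hx =>
  (ContDiffAt.comp x (contDiffAt_velocity ht (q := (x, t)) ⟨htt, hx⟩)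
    (contDiffAt_id.prodMk contDiffAt_const)).contDiffWithinAt

theorem contDiffOn_bulkVolume (ht : IsOpen times) {t : ℝ} (htt : t ∈ times) :
    ContDiffOn ℝ 1 (fun x => C.bulkVolume x t) (C.region t) := fun x hx =>
  (ContDiffAt.comp x (contDiffAt_bulkVolume ht (q := (x, t)) ⟨htt, hx⟩)
    (contDiffAt_id.prodMk contDiffAt_const)).contDiffWithinAt

theorem velocity_motion {X : Space} {t : ℝ} (hX : X ∈ C.body) (htt : t ∈ times) :
    C.velocity (C.motion X t) t = C.refVelocity X t := by
  rw [velocity, particle_motion hX htt]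

/-- The referential velocity gradient is the composition of the spatial velocity gradient with the
deformation gradient. -/
theorem fderiv_refVelocity (ht : IsOpen times) {X : Space} {t : ℝ} (hX : X ∈ C.body)
    (htt : t ∈ times) :
    fderiv ℝ (fun Y => C.refVelocity Y t) X =
      fderiv ℝ (fun y => C.velocity y t) (C.motion X t) ∘L C.defGrad X t := by
  have h1 : HasFDerivAt (fun Y => C.motion Y t) (C.defGrad X t) X :=
    ((contDiffAt_motion ht hX htt).differentiableAt (by norm_num)).hasFDerivAt
  have h2 := ((contDiffOn_velocity ht htt).contDiffAt ((isOpen_region ht htt).mem_nhds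
    (motion_mem_region t hX))).differentiableAt one_ne_zero |>.hasFDerivAt
  have h3 : HasFDerivAt (fun Y => C.refVelocity Y t) _ X :=
    (HasFDerivAt.comp X h2 h1).congr_of_eventuallyEq (by
      filter_upwards [C.isOpen_body.mem_nhds hX] with Y hY using (velocity_motion hY htt).symm)
  exact h3.fderiv

/-- Euler's formula: the rate of change of the Jacobian is the Jacobian times the divergence of the
velocity. -/
theorem hasDerivAt_det_defGrad (ht : IsOpen times) {X : Space} {t : ℝ} (hX : X ∈ C.body)
    (htt : t ∈ times) :
    HasDerivAt (fun τ => (C.defGrad X τ).det)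
      ((C.defGrad X t).det * divergence (fun y => C.velocity y t) (C.motion X t)) t := by
  have hdet : (C.defGrad X t).det ≠ 0 := (C.det_pos X hX t htt).ne'
  have h1 : HasFDerivAt (fun A : Tensor => A.det) (fderiv ℝ (fun A : Tensor => A.det)
      (C.defGrad X t)) (C.defGrad X t) :=
    ((contDiff_det (n := 1)).differentiable one_ne_zero _).hasFDerivAt
  have h2 := HasFDerivAt.comp_hasDerivAt t h1 (hasDerivAt_defGrad ht hX htt)
  rw [fderiv_det_apply hdet, fderiv_refVelocity ht hX htt, tr_comp_comm,
    ContinuousLinearMap.comp_assoc, self_comp_inverse hdet] at h2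
  exact h2

end Constituent

/-! ### Balls as test regions -/

theorem isOutwardUnitNormal_ball {c x : Space} {r : ℝ} (hr : 0 < r) (hx : x ∈ Metric.sphere c r) :
    ∃ n, IsOutwardUnitNormal (Metric.ball c r) x n := by
  set ρ : Space → ℝ := fun y => ‖y - c‖ ^ 2 - r ^ 2 with hρ
  have hd : ContDiff ℝ 1 ρ := ((contDiff_id.sub contDiff_const).norm_sq ℝ).sub contDiff_const
  have hxr : ‖x - c‖ = r := by rw [← dist_eq_norm]; exact hx
  refine ⟨_, univ, ρ, isOpen_univ, mem_univ _, hd.contDiffOn, by simp [hρ, hxr], fun h => ?_, ?_,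
    rfl⟩
  · have h1 : HasFDerivAt ρ (2 • (innerSL ℝ (x - c)).comp (ContinuousLinearMap.id ℝ Space)) x :=
      ((hasFDerivAt_id x).sub_const c).norm_sq.sub_const _
    have h2 : inner ℝ (∇ ρ x) (x - c) = 2 * r ^ 2 := by
      rw [inner_gradient_left, h1.fderiv, ← hxr, ← real_inner_self_eq_norm_sq]
      change 2 • inner ℝ (x - c) (x - c) = _
      rw [nsmul_eq_mul, Nat.cast_ofNat]
    rw [h, inner_zero_left] at h2
    nlinarith
  · ext y
    simp only [inter_univ, mem_univ, true_and, Metric.mem_ball, mem_ofPred_eq, hρ, sub_neg,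
      dist_eq_norm]
    exact (pow_lt_pow_iff_left₀ (norm_nonneg _) hr.le two_ne_zero).symm

theorem isRegularRegion_ball (c : Space) {r : ℝ} (hr : 0 < r) :
    IsRegularRegion (Metric.ball c r) := by
  have hf : frontier (Metric.ball c r) = Metric.sphere c r := frontier_ball c hr.ne'
  refine ⟨Metric.isOpen_ball, Metric.isBounded_ball, ?_, ?_⟩
  · rw [hf]
    refine ((isCompact_sphere c r).measure_lt_top_of_nhdsWithin fun x hx => ?_).ne
    obtain ⟨n, hn⟩ := isOutwardUnitNormal_ball hr hx
    obtain ⟨V, hV, hxV, hfin⟩ := hn.exists_nhds_area_lt_top Metric.isOpen_ball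
    exact ⟨_, inter_mem_nhdsWithin _ (hV.mem_nhds hxV), by rwa [hf] at hfin⟩
  · rw [hf]
    filter_upwards [ae_restrict_mem Metric.isClosed_sphere.measurableSet] with x hx
      using isOutwardUnitNormal_ball hr hx

theorem IsRegularRegion.integrableOn {Ω U : Set Space} (hΩ : IsRegularRegion Ω)
    (hΩU : closure Ω ⊆ U) {g : Space → ℝ} (hg : ContinuousOn g U) : IntegrableOn g Ω :=
  ((hg.mono hΩU).integrableOn_compact hΩ.isBounded.isCompact_closure).mono_set subset_closure

/-- A continuous function is nonnegative if and only if its integrals over all regular regions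
are. -/
theorem forall_nonneg_iff_forall_setIntegral_nonneg {U : Set Space} (hU : IsOpen U) {g : Space → ℝ}
    (hg : ContinuousOn g U) :
    (∀ x ∈ U, 0 ≤ g x) ↔
      ∀ Ω : Set Space, IsRegularRegion Ω → closure Ω ⊆ U → 0 ≤ ∫ x in Ω, g x := by
  refine ⟨fun h Ω hΩ hΩU => setIntegral_nonneg hΩ.isOpen.measurableSet fun x hx =>
    h x (hΩU (subset_closure hx)), fun h x hx => ?_⟩
  by_contra! hneg
  have hev : ∀ᶠ y in 𝓝 x, y ∈ U ∧ g y < g x / 2 :=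
    inter_mem (hU.mem_nhds hx)
      ((hg.continuousAt (hU.mem_nhds hx)).eventually_lt_const (by linarith))
  obtain ⟨r, hr, hball⟩ := Metric.nhds_basis_closedBall.mem_iff.1 hev
  have hreg := isRegularRegion_ball x hr
  have hcl : closure (Metric.ball x r) ⊆ U := fun y hy =>
    (hball (Metric.closure_ball_subset_closedBall hy)).1
  have h1 := h _ hreg hcl
  have h2 : ∫ y in Metric.ball x r, g y ≤ ∫ y in Metric.ball x r, g x / 2 :=
    setIntegral_mono_on (hreg.integrableOn hcl hg)
      (integrableOn_const (Metric.isBounded_ball.measure_lt_top).ne)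
      Metric.isOpen_ball.measurableSet fun y hy => (hball (Metric.ball_subset_closedBall hy)).2.le
  have h3 : 0 < volume.real (Metric.ball x r) :=
    ENNReal.toReal_pos (Metric.measure_ball_pos _ _ hr).ne'
      (Metric.isBounded_ball.measure_lt_top).ne
  rw [setIntegral_const, smul_eq_mul] at h2
  nlinarith

/-! ### Differentiation under the integral sign -/

theorem deriv_time_eq_fderiv {f : Space × ℝ → ℝ} {x : Space} {t : ℝ}
    (hf : DifferentiableAt ℝ f (x, t)) :
    HasDerivAt (fun τ => f (x, τ)) (fderiv ℝ f (x, t) (0, 1)) t :=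
  HasFDerivAt.comp_hasDerivAt t hf.hasFDerivAt ((hasDerivAt_const t x).prodMk (hasDerivAt_id t))

/-- The time derivative of the integral, over a fixed region with compact closure, of a field of
class `C¹` in space-time. -/
theorem hasDerivAt_setIntegral {f : Space × ℝ → ℝ} {N : Set (Space × ℝ)} (hN : IsOpen N)
    (hf : ContDiffOn ℝ 1 f N) {Ω : Set Space} (hΩm : MeasurableSet Ω)
    (hΩ : IsCompact (closure Ω)) {t : ℝ} (hΩN : ∀ x ∈ closure Ω, (x, t) ∈ N) :
    HasDerivAt (fun τ => ∫ x in Ω, f (x, τ)) (∫ x in Ω, deriv (fun τ => f (x, τ)) t) t := by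
  -- The region stays inside `N` for a short time.
  obtain ⟨u, v, -, hv, hΩu, htv, huv⟩ := generalized_tube_lemma hΩ
    (isCompact_singleton (x := t)) hN (by
      rintro ⟨x, τ⟩ ⟨hx, hτ⟩; obtain rfl : τ = t := hτ; exact hΩN x hx)
  obtain ⟨δ, hδ, hball⟩ := Metric.nhds_basis_closedBall.mem_iff.1 (hv.mem_nhds (htv rfl))
  have hsub : closure Ω ×ˢ Metric.closedBall t δ ⊆ N := fun p hp => huv ⟨hΩu hp.1, hball hp.2⟩
  have hcont : ContinuousOn (fun p : Space × ℝ => fderiv ℝ f p (0, 1)) N :=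
    (hf.continuousOn_fderiv_of_isOpen hN le_rfl).clm_apply continuousOn_const
  obtain ⟨C, hC⟩ := (hΩ.prod (isCompact_closedBall t δ)).exists_bound_of_continuousOn
    (hcont.mono hsub)
  have hdiff : ∀ p ∈ N, DifferentiableAt ℝ f p := fun p hp =>
    (hf.contDiffAt (hN.mem_nhds hp)).differentiableAt one_ne_zero
  have hslice : ∀ τ ∈ Metric.closedBall t δ, ContinuousOn (fun x => f (x, τ)) (closure Ω) :=
    fun τ hτ => hf.continuousOn.comp (by fun_prop) fun x hx => hsub ⟨hx, hτ⟩
  have htδ : t ∈ Metric.closedBall t δ := Metric.mem_closedBall_self hδ.le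
  have hΩfin : volume Ω < ⊤ := (measure_mono subset_closure).trans_lt hΩ.measure_lt_top
  have key := (hasDerivAt_integral_of_dominated_loc_of_deriv_le (μ := volume.restrict Ω)
    (F := fun τ x => f (x, τ)) (F' := fun τ x => fderiv ℝ f (x, τ) (0, 1)) (x₀ := t)
    (bound := fun _ => C) (Metric.ball_mem_nhds t hδ) ?_ ?_ ?_ ?_ ?_ ?_).2
  · convert! key using 1
    refine setIntegral_congr_fun hΩm fun x hx => ?_
    exact (deriv_time_eq_fderiv (hdiff _ (hsub ⟨subset_closure hx, htδ⟩))).deriv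
  · filter_upwards [Metric.ball_mem_nhds t hδ] with τ hτ
    exact ((hslice τ (Metric.ball_subset_closedBall hτ)).mono
      subset_closure).aestronglyMeasurable hΩm
  · exact ((hslice t htδ).integrableOn_compact hΩ).mono_set subset_closure
  · exact ((hcont.comp (by fun_prop) fun x hx => hsub ⟨hx, htδ⟩ : ContinuousOn
      (fun x : Space => fderiv ℝ f (x, t) (0, 1)) (closure Ω)).mono
      subset_closure).aestronglyMeasurable hΩm
  · filter_upwards [ae_restrict_mem hΩm] with x hx τ hτ
    exact hC (x, τ) ⟨subset_closure hx, Metric.ball_subset_closedBall hτ⟩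
  · exact integrableOn_const hΩfin.ne
  · filter_upwards [ae_restrict_mem hΩm] with x hx τ hτ
    exact deriv_time_eq_fderiv
      (hdiff _ (hsub ⟨subset_closure hx, Metric.ball_subset_closedBall hτ⟩))

/-! ### The local form of the dissipation inequalities -/

theorem tensorInner_eq (A B : Tensor) :
    tensorInner A B = tr (ContinuousLinearMap.adjoint A ∘L B) := rfl

/-- The stress power per unit referential volume: `T_R · (L F) = J (T · L)`. -/
theorem tensorInner_piola {F : Tensor} (hF : F.det ≠ 0) (T L : Tensor) :
    tensorInner (F.det • (T ∘L ContinuousLinearMap.adjoint (ContinuousLinearMap.inverse F)))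
      (L ∘L F) = F.det * tensorInner T L := by
  rw [tensorInner_eq, tensorInner_eq, map_smulₛₗ, ContinuousLinearMap.adjoint_comp,
    ContinuousLinearMap.adjoint_adjoint, conj_trivial, ContinuousLinearMap.smul_comp,
    ContinuousLinearMap.comp_assoc]
  have h : tr (ContinuousLinearMap.inverse F ∘L ContinuousLinearMap.adjoint T ∘L L ∘L F) =
      tr (ContinuousLinearMap.adjoint T ∘L L) := by
    rw [tr_comp_comm, ContinuousLinearMap.comp_assoc, ContinuousLinearMap.comp_assoc,
      self_comp_inverse hF]
    rfl
  rw [← h]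
  simp only [tr, ContinuousLinearMap.toLinearMap_smul, map_smul, smul_eq_mul]

namespace Mixture

variable {M : Mixture} {t : ℝ}

theorem contDiffAt_energy {q : Space × ℝ} (hq : q ∈ M.solid.engaged) :
    ContDiffAt ℝ 1 (fun q : Space × ℝ => M.energy q.1 q.2) q := by
  have h1 : ContDiffAt ℝ 1 (fun q : Space × ℝ => M.refEnergy (M.solid.particle q.1 q.2) q.2) q := by
    have hmem := Constituent.particle_prod_mem hq
    exact ContDiffAt.comp q (M.contDiffOn_refEnergy.contDiffAt
      ((M.solid.isOpen_body.prod M.isOpen_times).mem_nhds hmem))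
      (Constituent.contDiffAt_particle_prod M.isOpen_times hq)
  exact (Constituent.contDiffAt_bulkVolume M.isOpen_times hq).mul h1

theorem contDiffOn_energy_engaged :
    ContDiffOn ℝ 1 (fun q : Space × ℝ => M.energy q.1 q.2) M.solid.engaged := fun _ hq =>
  (contDiffAt_energy hq).contDiffWithinAt

theorem contDiffOn_energy (ht : t ∈ M.times) :
    ContDiffOn ℝ 1 (fun x => M.energy x t) (M.solid.region t) := fun x hx =>
  (ContDiffAt.comp x (contDiffAt_energy (q := (x, t)) ⟨ht, hx⟩)
    (contDiffAt_id.prodMk contDiffAt_const)).contDiffWithinAt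

theorem contDiffOn_massFlux (ht : t ∈ M.times) :
    ContDiffOn ℝ 1 (fun x => M.chemPotential x t • M.flux x t) (M.solid.region t) := by
  have hsub := M.superposed t ht
  have h1 := (Constituent.contDiffOn_bulkVolume (C := M.fluid) M.isOpen_times ht).mono hsub
  have h2 := (Constituent.contDiffOn_velocity (C := M.fluid) M.isOpen_times ht).mono hsub
  have h3 := Constituent.contDiffOn_velocity (C := M.solid) M.isOpen_times ht
  have h4 := M.contDiffOn_pressure t ht
  exact (contDiffOn_const.mul h4).smul ((h1.div_const _).smul (h2.sub h3))

theorem continuousOn_stress (ht : t ∈ M.times) :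
    ContinuousOn (fun x => M.stress x t) (M.solid.region t) := by
  have h1 := (Constituent.contDiffOn_bulkVolume (C := M.fluid) M.isOpen_times ht).mono
    (M.superposed t ht)
  exact (M.continuousOn_solidStress t ht).add
    (((h1.continuousOn.mul (M.contDiffOn_pressure t ht).continuousOn).neg).smul continuousOn_const)

/-- The local dissipation `T · grad v_s - div (μ h) - ∂ψ_s/∂t - div (ψ_s v_s)`. -/
noncomputable def localDissipation (M : Mixture) (t : ℝ) (x : Space) : ℝ :=
  tensorInner (M.stress x t) (fderiv ℝ (fun y => M.solid.velocity y t) x) -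
    divergence (fun y => M.chemPotential y t • M.flux y t) x -
      (deriv (fun τ => M.energy x τ) t +
        divergence (fun y => M.energy y t • M.solid.velocity y t) x)

theorem continuousOn_stressPower (ht : t ∈ M.times) :
    ContinuousOn (fun x => tensorInner (M.stress x t)
      (fderiv ℝ (fun y => M.solid.velocity y t) x)) (M.solid.region t) := by
  have hR := Constituent.isOpen_region (C := M.solid) M.isOpen_times ht
  have h1 := (Constituent.contDiffOn_velocity (C := M.solid) M.isOpen_times
    ht).continuousOn_fderiv_of_isOpen hR le_rfl
  exact continuous_tr.comp_continuousOn
    ((ContinuousLinearMap.adjoint.continuous.comp_continuousOn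
      (continuousOn_stress ht)).clm_comp h1)

theorem continuousOn_deriv_energy (ht : t ∈ M.times) :
    ContinuousOn (fun x => deriv (fun τ => M.energy x τ) t) (M.solid.region t) := by
  have h1 : ContinuousOn (fun q : Space × ℝ =>
      fderiv ℝ (fun q : Space × ℝ => M.energy q.1 q.2) q (0, 1)) M.solid.engaged :=
    (contDiffOn_energy_engaged.continuousOn_fderiv_of_isOpen
      (Constituent.isOpen_engaged M.isOpen_times) le_rfl).clm_apply continuousOn_const
  have h2 : ContinuousOn (fun x : Space =>
      fderiv ℝ (fun q : Space × ℝ => M.energy q.1 q.2) (x, t) (0, 1)) (M.solid.region t) :=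
    h1.comp (f := fun x : Space => (x, t)) (by fun_prop) fun x hx => ⟨ht, hx⟩
  refine h2.congr fun x hx => ?_
  exact (deriv_time_eq_fderiv (f := fun q : Space × ℝ => M.energy q.1 q.2)
    ((contDiffAt_energy (q := (x, t)) ⟨ht, hx⟩).differentiableAt one_ne_zero)).deriv

theorem contDiffOn_energyFlux (ht : t ∈ M.times) :
    ContDiffOn ℝ 1 (fun x => M.energy x t • M.solid.velocity x t) (M.solid.region t) :=
  (contDiffOn_energy ht).smul (Constituent.contDiffOn_velocity M.isOpen_times ht)

theorem continuousOn_localDissipation (ht : t ∈ M.times) :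
    ContinuousOn (M.localDissipation t) (M.solid.region t) := by
  have hR := Constituent.isOpen_region (C := M.solid) M.isOpen_times ht
  exact ((continuousOn_stressPower ht).sub
    (continuousOn_divergence hR (contDiffOn_massFlux ht))).sub
    ((continuousOn_deriv_energy ht).add (continuousOn_divergence hR (contDiffOn_energyFlux ht)))

/-- By the divergence theorem, the spatial dissipation inequality for a control volume says that the
integral of the local dissipation is nonnegative. -/
theorem spatialDissipation_iff (ht : t ∈ M.times) {Ω : Set Space} (hΩ : IsRegularRegion Ω)
    (hΩR : closure Ω ⊆ M.solid.region t) :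
    M.SpatialDissipation t Ω ↔ 0 ≤ ∫ x in Ω, M.localDissipation t x := by
  have hR := Constituent.isOpen_region (C := M.solid) M.isOpen_times ht
  have hder : HasDerivAt (fun τ => ∫ x in Ω, M.energy x τ)
      (∫ x in Ω, deriv (fun τ => M.energy x τ) t) t :=
    hasDerivAt_setIntegral (f := fun q : Space × ℝ => M.energy q.1 q.2)
      (Constituent.isOpen_engaged M.isOpen_times) contDiffOn_energy_engaged
      hΩ.isOpen.measurableSet hΩ.isBounded.isCompact_closure fun x hx => ⟨ht, hΩR hx⟩
  have i1 := hΩ.integrableOn hΩR (continuousOn_stressPower ht)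
  have i2 := hΩ.integrableOn hΩR (continuousOn_divergence hR (contDiffOn_massFlux ht))
  have i3 := hΩ.integrableOn hΩR (continuousOn_deriv_energy ht)
  have i4 := hΩ.integrableOn hΩR (continuousOn_divergence hR (contDiffOn_energyFlux ht))
  have hint : ∫ x in Ω, M.localDissipation t x =
      ((∫ x in Ω, tensorInner (M.stress x t) (fderiv ℝ (fun y => M.solid.velocity y t) x)) -
        ∫ x in Ω, divergence (fun y => M.chemPotential y t • M.flux y t) x) -
      ((∫ x in Ω, deriv (fun τ => M.energy x τ) t) +
        ∫ x in Ω, divergence (fun y => M.energy y t • M.solid.velocity y t) x) := by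
    have i12 : IntegrableOn (fun x => tensorInner (M.stress x t)
        (fderiv ℝ (fun y => M.solid.velocity y t) x) -
          divergence (fun y => M.chemPotential y t • M.flux y t) x) Ω := i1.sub i2
    have i34 : IntegrableOn (fun x => deriv (fun τ => M.energy x τ) t +
        divergence (fun y => M.energy y t • M.solid.velocity y t) x) Ω := i3.add i4
    rw [← integral_sub i1 i2, ← integral_add i3 i4, ← integral_sub i12 i34]
    rfl
  rw [hint]
  unfold SpatialDissipation
  rw [hΩ.boundaryFlux_eq hR hΩR (contDiffOn_energyFlux ht),
    hΩ.boundaryFlux_eq hR hΩR (contDiffOn_massFlux ht)]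
  constructor
  · rintro ⟨D, hD, hle⟩
    rw [hD.unique hder] at hle
    linarith
  · intro h
    exact ⟨_, hder, by linarith⟩

/-- Transport of the energy: differentiating `ψ_s J = Ψ_s` along the motion of the solid. -/
theorem deriv_refEnergy {X : Space} (ht : t ∈ M.times) (hX : X ∈ M.solid.body) :
    deriv (fun τ => M.refEnergy X τ) t = (M.solid.defGrad X t).det *
      (deriv (fun τ => M.energy (M.solid.motion X t) τ) t +
        divergence (fun y => M.energy y t • M.solid.velocity y t) (M.solid.motion X t)) := by
  set x := M.solid.motion X t with hx
  have hxR : x ∈ M.solid.region t := Constituent.motion_mem_region t hX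
  have hR := Constituent.isOpen_region (C := M.solid) M.isOpen_times ht
  have hq : (x, t) ∈ M.solid.engaged := ⟨ht, hxR⟩
  have he := (contDiffAt_energy hq).differentiableAt one_ne_zero
  set E := fderiv ℝ (fun q : Space × ℝ => M.energy q.1 q.2) (x, t)
  have hv : HasDerivAt (fun τ => M.solid.motion X τ) (M.solid.velocity x t) t := by
    rw [hx, Constituent.velocity_motion hX ht,
      Constituent.refVelocity_eq M.isOpen_times (p := (X, t)) ⟨hX, ht⟩]
    exact Constituent.hasDerivAt_motion M.isOpen_times (p := (X, t)) ⟨hX, ht⟩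
  have h1 : HasDerivAt (fun τ => M.energy (M.solid.motion X τ) τ)
      (E (M.solid.velocity x t, 1)) t :=
    HasFDerivAt.comp_hasDerivAt (f := fun τ => (M.solid.motion X τ, τ)) t he.hasFDerivAt
      (hv.prodMk (hasDerivAt_id t))
  have h2 := h1.mul (Constituent.hasDerivAt_det_defGrad M.isOpen_times hX ht)
  have h3 : HasDerivAt (fun τ => M.refEnergy X τ) _ t := h2.congr_of_eventuallyEq (by
    filter_upwards [M.isOpen_times.mem_nhds ht] with τ hτ
    have hdet : (M.solid.defGrad X τ).det ≠ 0 := (M.solid.det_pos X hX τ hτ).ne'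
    change _ = M.energy _ τ * (M.solid.defGrad X τ).det
    rw [energy, Constituent.bulkVolume, Constituent.particle_motion hX hτ]
    field_simp)
  have h4 : HasFDerivAt (fun y => M.energy y t) (E ∘L .inl ℝ Space ℝ) x :=
    HasFDerivAt.comp (f := fun y : Space => ((y, t) : Space × ℝ)) x he.hasFDerivAt
      (hasFDerivAt_prodMk_left x t)
  have h5 : deriv (fun τ => M.energy x τ) t = E (0, 1) := (deriv_time_eq_fderiv he).deriv
  have h6 : E (M.solid.velocity x t, 1) = E (M.solid.velocity x t, 0) + E (0, 1) := by
    rw [← map_add]; simp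
  rw [h3.deriv, divergence_smul h4.differentiableAt
    (((Constituent.contDiffOn_velocity M.isOpen_times ht).contDiffAt
      (hR.mem_nhds hxR)).differentiableAt one_ne_zero), h4.fderiv, h5, h6]
  simp only [ContinuousLinearMap.comp_apply, ContinuousLinearMap.inl_apply]
  ring

theorem smul_refFlux_eq_piola (X : Space) :
    M.chemPotential (M.solid.motion X t) t • M.refFlux X t =
      piola (fun Y => M.solid.motion Y t) (fun x => M.chemPotential x t • M.flux x t) X := by
  rw [refFlux, piola, map_smul, smul_comm]
  rfl

theorem contDiffOn_smul_refFlux (ht : t ∈ M.times) :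
    ContDiffOn ℝ 1 (fun X => M.chemPotential (M.solid.motion X t) t • M.refFlux X t)
      M.solid.body := fun X hX => by
  have hR := Constituent.isOpen_region (C := M.solid) M.isOpen_times ht
  simp only [smul_refFlux_eq_piola]
  exact (contDiffAt_piola (Constituent.contDiffAt_motion M.isOpen_times hX ht)
    (M.solid.det_pos X hX t ht).ne' ((contDiffOn_massFlux ht).contDiffAt
      (hR.mem_nhds (Constituent.motion_mem_region t hX)))).contDiffWithinAt

theorem divergence_smul_refFlux (ht : t ∈ M.times) {X : Space} (hX : X ∈ M.solid.body) :
    divergence (fun X => M.chemPotential (M.solid.motion X t) t • M.refFlux X t) X =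
      (M.solid.defGrad X t).det *
        divergence (fun x => M.chemPotential x t • M.flux x t) (M.solid.motion X t) := by
  have hR := Constituent.isOpen_region (C := M.solid) M.isOpen_times ht
  simp only [smul_refFlux_eq_piola]
  exact divergence_piola (Constituent.contDiffAt_motion M.isOpen_times hX ht)
    (M.solid.det_pos X hX t ht).ne' (((contDiffOn_massFlux ht).contDiffAt
      (hR.mem_nhds (Constituent.motion_mem_region t hX))).differentiableAt one_ne_zero)

theorem refStressPower_eq (ht : t ∈ M.times) {X : Space} (hX : X ∈ M.solid.body) :
    tensorInner (M.refStress X t) (fderiv ℝ (fun Y => M.solid.refVelocity Y t) X) =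
      (M.solid.defGrad X t).det * tensorInner (M.stress (M.solid.motion X t) t)
        (fderiv ℝ (fun y => M.solid.velocity y t) (M.solid.motion X t)) := by
  rw [Constituent.fderiv_refVelocity M.isOpen_times hX ht, refStress]
  exact tensorInner_piola (M.solid.det_pos X hX t ht).ne' _ _

theorem continuousOn_motion (ht : t ∈ M.times) :
    ContinuousOn (fun X => M.solid.motion X t) M.solid.body := fun _ hX =>
  (Constituent.contDiffAt_motion M.isOpen_times hX ht).continuousAt.continuousWithinAt

theorem continuousOn_det_mul_comp (ht : t ∈ M.times) {g : Space → ℝ}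
    (hg : ContinuousOn g (M.solid.region t)) :
    ContinuousOn (fun X => (M.solid.defGrad X t).det * g (M.solid.motion X t)) M.solid.body := by
  refine ContinuousOn.mul (fun X hX => ?_) (hg.comp (continuousOn_motion ht)
    fun X hX => Constituent.motion_mem_region t hX)
  have h : ContDiffAt ℝ 1 (fun Y => M.solid.defGrad Y t) X :=
    (Constituent.contDiffAt_motion M.isOpen_times hX ht).fderiv_right (by norm_num)
  exact ((contDiff_det (n := 1)).continuous.continuousAt.comp
    h.continuousAt).continuousWithinAt

/-- By the divergence theorem and the Piola identity, the referential dissipation inequality for a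
body part says that the integral of `J` times the local dissipation is nonnegative. -/
theorem referentialDissipation_iff (ht : t ∈ M.times) {P : Set Space} (hP : IsRegularRegion P)
    (hPB : closure P ⊆ M.solid.body) :
    M.ReferentialDissipation t P ↔
      0 ≤ ∫ X in P, (M.solid.defGrad X t).det * M.localDissipation t (M.solid.motion X t) := by
  have hR := Constituent.isOpen_region (C := M.solid) M.isOpen_times ht
  have c1 : ContinuousOn (fun X => tensorInner (M.refStress X t)
      (fderiv ℝ (fun Y => M.solid.refVelocity Y t) X)) M.solid.body :=
    (continuousOn_det_mul_comp ht (continuousOn_stressPower ht)).congr fun X hX =>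
      refStressPower_eq ht hX
  have c3 : ContinuousOn (fun X => deriv (fun τ => M.refEnergy X τ) t) M.solid.body :=
    (continuousOn_det_mul_comp ht ((continuousOn_deriv_energy ht).add
      (continuousOn_divergence hR (contDiffOn_energyFlux ht)))).congr fun X hX =>
        deriv_refEnergy ht hX
  have i1 := hP.integrableOn hPB c1
  have i2 := hP.integrableOn hPB
    (continuousOn_divergence M.solid.isOpen_body (contDiffOn_smul_refFlux ht))
  have i3 := hP.integrableOn hPB c3
  have hint : ∫ X in P, (M.solid.defGrad X t).det * M.localDissipation t (M.solid.motion X t) =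
      ((∫ X in P, tensorInner (M.refStress X t)
          (fderiv ℝ (fun Y => M.solid.refVelocity Y t) X)) -
        ∫ X in P, divergence
          (fun X => M.chemPotential (M.solid.motion X t) t • M.refFlux X t) X) -
      ∫ X in P, deriv (fun τ => M.refEnergy X τ) t := by
    have i12 : IntegrableOn (fun X => tensorInner (M.refStress X t)
        (fderiv ℝ (fun Y => M.solid.refVelocity Y t) X) - divergence
          (fun X => M.chemPotential (M.solid.motion X t) t • M.refFlux X t) X) P := i1.sub i2
    rw [← integral_sub i1 i2, ← integral_sub i12 i3]
    refine setIntegral_congr_fun hP.isOpen.measurableSet fun X hX => ?_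
    have hXB := hPB (subset_closure hX)
    simp only [localDissipation]
    rw [refStressPower_eq ht hXB, divergence_smul_refFlux ht hXB, deriv_refEnergy ht hXB]
    ring
  rw [hint, ReferentialDissipation,
    hP.boundaryFlux_eq M.solid.isOpen_body hPB (contDiffOn_smul_refFlux ht)]
  constructor <;> intro h <;> linarith

end Mixture

end Poro

/-! ### Equivalence of the dissipation inequalities -/

theorem mainTheorem2 (M : Poro.Mixture) (t : ℝ) (ht : t ∈ M.times) :
    (∀ Ω : Set Poro.Space, Poro.IsRegularRegion Ω → closure Ω ⊆ M.solid.region t →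
        M.SpatialDissipation t Ω) ↔
      (∀ P : Set Poro.Space, Poro.IsRegularRegion P → closure P ⊆ M.solid.body →
        M.ReferentialDissipation t P) := by
  have hR := Poro.Constituent.isOpen_region (C := M.solid) M.isOpen_times ht
  have hg := Poro.Mixture.continuousOn_localDissipation ht
  have h1 := Poro.forall_nonneg_iff_forall_setIntegral_nonneg hR hg
  have h2 := Poro.forall_nonneg_iff_forall_setIntegral_nonneg M.solid.isOpen_body
    (Poro.Mixture.continuousOn_det_mul_comp ht hg)
  have h3 : (∀ x ∈ M.solid.region t, 0 ≤ M.localDissipation t x) ↔ ∀ X ∈ M.solid.body,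
      0 ≤ (M.solid.defGrad X t).det * M.localDissipation t (M.solid.motion X t) := by
    constructor
    · intro h X hX
      exact mul_nonneg (M.solid.det_pos X hX t ht).le
        (h _ (Poro.Constituent.motion_mem_region t hX))
    · rintro h _ ⟨X, hX, rfl⟩
      exact nonneg_of_mul_nonneg_right (h X hX) (M.solid.det_pos X hX t ht)
  calc _ ↔ ∀ Ω : Set Poro.Space, Poro.IsRegularRegion Ω → closure Ω ⊆ M.solid.region t →
        0 ≤ ∫ x in Ω, M.localDissipation t x :=
        forall_congr' fun Ω => forall₂_congr fun hΩ hΩR =>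
          Poro.Mixture.spatialDissipation_iff ht hΩ hΩR
    _ ↔ ∀ P : Set Poro.Space, Poro.IsRegularRegion P → closure P ⊆ M.solid.body →
        0 ≤ ∫ X in P, (M.solid.defGrad X t).det * M.localDissipation t (M.solid.motion X t) :=
        h1.symm.trans (h3.trans h2)
    _ ↔ _ := forall_congr' fun P => forall₂_congr fun hP hPB =>
        (Poro.Mixture.referentialDissipation_iff ht hP hPB).symm
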